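/- Let $\mathbb B$ be the open unit disc of $\mathbb C$ and $d\mu=\frac1\pi\,dx\,dy$. For $0<q<\infty$ let $A^q$ be the Bergman space of all analytic $f$ on $\mathbb B$ with $\|f\|_{A^q}=\left(\int_{\mathbb B}|f|^q\,d\mu\right)^{1/q}<\infty$. Let $m\ge 2$ be an integer. For an analytic function $f(z)=\sum_{k\ge0}a_kz^k$ on $\mathbb B$ put $$\mathcal H(f)(z)=\sum_{k=0}^{\infty}\left(\sum_{i_2,\dots,i_m=0}^{\infty}\frac{a_{i_2}\cdots a_{i_m}}{k+i_2+\cdots+i_m+1}\right)z^k,$$ where the inner multiple series is the limit, as $l\to\infty$, of its partial sums over $0\le i_2,\dots,i_m\le l$. Let $2<p<\infty$. Theorem. For every $f\in A^{p(m-1)}$ all these multiple series converge and the power series $\mathcal H(f)$ converges on $\mathbb B$. Put $T_{\mathcal H}(f)=\|f\|_{A^{p(m-1)}}^{2-m}\,\mathcal H(f)$ for $0\ne f\in A^{p(m-1)}$ and $T_{\mathcal H}(0)=0$. Then $T_{\mathcal H}$ maps $A^{p(m-1)}$ into $A^p$; it is positively homogeneous, i.e. $T_{\mathcal H}(tf)=t\,T_{\mathcal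 H}(f)$ for all $t>0$ and $f\in A^{p(m-1)}$; and it is bounded, i.e. there is $M>0$ with $\|T_{\mathcal H}(f)\|_{A^p}\le M\|f\|_{A^{p(m-1)}}$ for all $f\in A^{p(m-1)}$. Its norm $\|T_{\mathcal H}\|=\sup\{\|T_{\mathcal H}(f)\|_{A^p}:\|f\|_{A^{p(m-1)}}=1\}$ satisfies: (i) if $4\le p<\infty$, then $\|T_{\mathcal H}\|\le\dfrac{\pi}{\sin(2\pi/p)}$; (ii) if $2<p\le4$, then $\|T_{\mathcal H}\|\le 4^{\frac4p-1}\sqrt\pi\,\dfrac{\Gamma(1-\frac2p)}{\Gamma(\frac32-\frac2p)}$. -/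

import Mathlib

open Filter Topology MeasureTheory

noncomputable section

/-- The open unit disc of the complex plane. -/
def disc : Set ℂ := Metric.ball (0 : ℂ) 1

/-- The normalized Lebesgue measure `dx dy / π` on the open unit disc. -/
def discMeasure : Measure ℂ := (ENNReal.ofReal Real.pi)⁻¹ • volume.restrict disc

/-- `f` represents an element of the Bergman space `A^p`: it is analytic on the disc and `|f|^p` is
integrable there. Only the values of `f` on the disc matter. -/
def MemBergman (p : ℝ) (f : ℂ → ℂ) : Prop :=
  AnalyticOnNhd ℂ f disc ∧ Integrable (fun z => ‖f z‖ ^ p) discMeasure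

/-- The Bergman norm `(∫ |f|^p dμ)^(1/p)`. -/
def bergmanNorm (p : ℝ) (f : ℂ → ℂ) : ℝ :=
  (∫ z, ‖f z‖ ^ p ∂discMeasure) ^ (1 / p)

/-- The `k`-th Taylor coefficient of `f` at the origin. -/
def taylorCoeff (f : ℂ → ℂ) (k : ℕ) : ℂ :=
  iteratedDeriv k f 0 / (k.factorial : ℂ)

/-- The `m`-order infinite dimensional Hilbert tensor. -/
def hilbertTensor (m : ℕ) (i : Fin m → ℕ) : ℝ :=
  1 / (((∑ r, i r : ℕ) : ℝ) + 1)

/-- The partial sum, over all `i₂, …, iₘ ∈ {0, …, l}`, of the multiple series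
`∑ ℋ_{k i₂ ⋯ iₘ} a_{i₂} ⋯ a_{iₘ}`. -/
def hilbertPartialSum (m : ℕ) (a : ℕ → ℂ) (k l : ℕ) : ℂ :=
  ∑ i ∈ Fintype.piFinset (fun _ : Fin (m - 1) => Finset.range (l + 1)),
    (hilbertTensor (m - 1 + 1) (Fin.cons k i) : ℂ) * ∏ r, a (i r)

/-- The sum of the multiple series `∑_{i₂, …, iₘ ≥ 0} ℋ_{k i₂ ⋯ iₘ} a_{i₂} ⋯ a_{iₘ}`, as the limit of
its partial sums over `{0, …, l}^(m-1)`; for `m ≥ 3` it need not converge absolutely. -/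
def hilbertCoeff (m : ℕ) (a : ℕ → ℂ) (k : ℕ) : ℂ :=
  limUnder atTop (fun l : ℕ => hilbertPartialSum m a k l)

/-- The Hilbert tensor operator `ℋ(f)(z) = ∑_k (∑ ℋ_{k i₂ ⋯ iₘ} a_{i₂} ⋯ a_{iₘ}) z^k`. -/
def hilbertOp (m : ℕ) (f : ℂ → ℂ) (z : ℂ) : ℂ :=
  ∑' k : ℕ, hilbertCoeff m (taylorCoeff f) k * z ^ k

/-- All series in the definition of `ℋ(f)` converge: the multiple series of every coefficient, and
the resulting power series at every point of the disc. -/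
def HilbertOpConverges (m : ℕ) (f : ℂ → ℂ) : Prop :=
  (∀ k : ℕ, ∃ c : ℂ,
      Tendsto (fun l : ℕ => hilbertPartialSum m (taylorCoeff f) k l) atTop (𝓝 c)) ∧
    ∀ z ∈ disc, Summable (fun k : ℕ => hilbertCoeff m (taylorCoeff f) k * z ^ k)

open Classical in
/-- `T_ℋ(f) = ‖f‖^(2-m) ℋ(f)` with the norm of `A^(p(m-1))`, and `T_ℋ(0) = 0`. -/
def hilbertT (m : ℕ) (p : ℝ) (f : ℂ → ℂ) (z : ℂ) : ℂ :=
  if ∀ w ∈ disc, f w = 0 then 0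
  else ((bergmanNorm (p * ((m : ℝ) - 1)) f ^ (2 - (m : ℤ)) : ℝ) : ℂ) * hilbertOp m f z

/-- `T` maps `A^q` into `A^p`. -/
def MapsBergman (q p : ℝ) (T : (ℂ → ℂ) → ℂ → ℂ) : Prop :=
  ∀ f, MemBergman q f → MemBergman p (T f)

/-- `T (t f) = t T f` on the disc for all `t > 0` and `f ∈ A^q`. -/
def IsPosHomogeneous (q : ℝ) (T : (ℂ → ℂ) → ℂ → ℂ) : Prop :=
  ∀ t : ℝ, 0 < t → ∀ f, MemBergman q f →
    ∀ z ∈ disc, T (fun w => (t : ℂ) * f w) z = (t : ℂ) * T f z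

/-- `‖T f‖ ≤ M ‖f‖` on `A^q`, with the norm of `A^p` on the left, for some `M > 0`. -/
def IsBoundedOperator (q p : ℝ) (T : (ℂ → ℂ) → ℂ → ℂ) : Prop :=
  ∃ M : ℝ, 0 < M ∧ ∀ f, MemBergman q f → bergmanNorm p (T f) ≤ M * bergmanNorm q f

/-- The operator norm `sup {‖T f‖_{A^p} : ‖f‖_{A^q} = 1}` (meaningful for bounded `T`). -/
def bergmanOpNorm (q p : ℝ) (T : (ℂ → ℂ) → ℂ → ℂ) : ℝ :=
  sSup {r : ℝ | ∃ f, MemBergman q f ∧ bergmanNorm q f = 1 ∧ r = bergmanNorm p (T f)}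

end

/-! Write `N = m - 1` and let `S_l` be the Taylor partial sums of `f`. Since `1 / (n + 1)` is the
`n`-th moment of `dt` on `[0, 1]`, a partial multiple sum is `∫ t^k S_l(t)^N dt`. In the limit the
`k`-th coefficient is `∫ t^k f(t)^N dt`, and summing over `k` gives `∫ f(t)^N / (1 - t z) dt`. By
Cauchy's theorem the segment may be replaced by the path `φ_t(z) = t / (1 - (1 - t) z)`, so that
`ℋ(f)(z) = ∫ ω_t(z) f(φ_t(z))^N dt` with `ω_t(z) = 1 / (1 - (1 - t) z)` (`hasSum_hilbertCoeff`).

For the limit in `l` a majorant is needed. Functions in `A^(pN)` are `O((1 - |z|)^(-2/(pN)))`, so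
the Taylor coefficients have sums `O(n^β)` for any `β > 2/(pN)` (`exists_norm_sum_taylorCoeff_le`).
As `p > 2`, some such `β` has `β N < 1`. Abel summation then bounds `S_l` along the path by a
multiple of `(1 - t)^(-β)`, uniformly in `l`, and the `N`-th power of this is integrable.

For the norm, `φ_t' = t (1 - t) ω_t^2` has real Jacobian `(t (1 - t))^2 |ω_t|^4`. Hence `g ↦ ω_t · g
∘ φ_t` has norm at most `C(t)` on `A^p` once `|ω_t|^(p-4) ≤ C(t)^p (t (1 - t))^2`, and Minkowski's
inequality gives the bound `∫ C(t) dt`. The cases `p ≥ 4` and `p ≤ 4` use an upper and a lower bound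
of `|ω_t|`; both integrals are beta integrals. Finally `g = f^N` satisfies `|g|^p = |f|^(pN)`. -/

noncomputable section

/-! ### Pointwise growth of Bergman functions -/

lemma mem_disc {z : ℂ} : z ∈ disc ↔ ‖z‖ < 1 := by simp [disc]

lemma isOpen_disc : IsOpen disc := Metric.isOpen_ball

lemma discMeasure_eq :
    discMeasure = (ENNReal.ofReal Real.pi)⁻¹ • volume.restrict disc := rfl

lemma ofReal_norm_rpow {E : Type*} [SeminormedAddCommGroup E] (x : E) {q : ℝ} (hq : 0 ≤ q) :
    ENNReal.ofReal (‖x‖ ^ q) = ‖x‖ₑ ^ q := by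
  rw [← ENNReal.ofReal_rpow_of_nonneg (norm_nonneg _) hq, ofReal_norm]

lemma MemBergman.lintegral_lt_top {q : ℝ} (hq : 0 ≤ q) {f : ℂ → ℂ} (hf : MemBergman q f) :
    ∫⁻ z in disc, ‖f z‖ₑ ^ q < ⊤ := by
  have h := hf.2.lintegral_lt_top
  rw [discMeasure_eq, lintegral_smul_measure, smul_eq_mul] at h
  simp_rw [ofReal_norm_rpow _ hq] at h
  by_contra hc
  rw [not_lt, top_le_iff] at hc
  rw [hc, ENNReal.mul_top (by simp)] at h
  exact lt_irrefl _ h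

/-- The centre value of an analytic function is at most its mean over a circle. -/
lemma enorm_mul_two_pi_le_lintegral_circle {f : ℂ → ℂ} (hf : DifferentiableOn ℂ f disc) {z : ℂ}
    {r : ℝ} (hr : 0 < r) (hzr : r < 1 - ‖z‖) :
    ‖f z‖ₑ * ENNReal.ofReal (2 * Real.pi) ≤
      ∫⁻ θ in Set.Ioo (-Real.pi) Real.pi,
        ‖f (z + r * (Real.cos θ + Real.sin θ * Complex.I))‖ₑ := by
  have hsub : Metric.closedBall z |r| ⊆ disc := by
    intro w hw
    rw [abs_of_pos hr, Metric.mem_closedBall, dist_eq_norm] at hw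
    rw [mem_disc]
    calc ‖w‖ = ‖(w - z) + z‖ := by simp
      _ ≤ ‖w - z‖ + ‖z‖ := norm_add_le _ _
      _ < 1 := by linarith
  have hd : DiffContOnCl ℂ f (Metric.ball z |r|) := by
    apply DifferentiableOn.diffContOnCl
    rw [closure_ball _ (by positivity)]
    exact hf.mono hsub
  have h := hd.circleAverage
  rw [Real.circleAverage_def] at h
  -- Circle averages run over `[0, 2π]`, polar coordinates over `(-π, π)`; periodicity moves one to
  -- the other.
  have hper : Function.Periodic (fun θ => f (circleMap z r θ)) (2 * Real.pi) := by
    intro θ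
    simp [(periodic_circleMap z r) θ]
  have h2 := hper.intervalIntegral_add_eq 0 (-Real.pi)
  rw [zero_add, show -Real.pi + 2 * Real.pi = Real.pi by ring] at h2
  rw [h2] at h
  have h3 : f z * (2 * Real.pi : ℝ) = ∫ θ in (-Real.pi)..Real.pi, f (circleMap z r θ) := by
    rw [← h, Complex.real_smul]
    have : (2 * Real.pi : ℝ) ≠ 0 := by positivity
    have : ((2 * Real.pi : ℝ) : ℂ) ≠ 0 := by exact_mod_cast this
    push_cast at this ⊢
    field_simp
  have h4 : ‖f z‖ₑ * ENNReal.ofReal (2 * Real.pi) = ‖f z * (2 * Real.pi : ℝ)‖ₑ := by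
    rw [enorm_mul]
    congr 1
    rw [← ofReal_norm, Complex.norm_real, Real.norm_of_nonneg (by positivity)]
  rw [h4, h3, intervalIntegral.integral_of_le (by linarith [Real.pi_pos]),
    integral_Ioc_eq_integral_Ioo]
  refine (enorm_integral_le_lintegral_enorm _).trans (le_of_eq ?_)
  simp only [circleMap, Complex.exp_mul_I, Complex.ofReal_cos, Complex.ofReal_sin]

lemma measurable_indicator_disc {f : ℂ → ℂ} (hf : ContinuousOn f disc) :
    Measurable (disc.indicator f) := by
  classical
  rw [← Set.piecewise_eq_indicator]
  exact hf.measurable_piecewise continuousOn_const isOpen_disc.measurableSet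

/-- The centre value of an analytic function is at most its mean over a disc. -/
lemma enorm_mul_volume_le_lintegral_ball {f : ℂ → ℂ} (hf : DifferentiableOn ℂ f disc) {z : ℂ}
    (hz : z ∈ disc) :
    ‖f z‖ₑ * ENNReal.ofReal (Real.pi * (1 - ‖z‖) ^ 2) ≤
      ∫⁻ w in Metric.ball z (1 - ‖z‖), ‖f w‖ₑ := by
  set R := 1 - ‖z‖ with hR
  have hR0 : 0 < R := by rw [mem_disc] at hz; linarith
  have hsub : Metric.ball z R ⊆ disc := by
    intro w hw
    rw [Metric.mem_ball, dist_eq_norm] at hw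
    rw [mem_disc]
    calc ‖w‖ = ‖(w - z) + z‖ := by simp
      _ ≤ ‖w - z‖ + ‖z‖ := norm_add_le _ _
      _ < 1 := by linarith
  set g : ℂ → ENNReal := fun w => (Metric.ball (0 : ℂ) R).indicator
    (fun w => ‖disc.indicator f (z + w)‖ₑ) w with hg
  have hgm : Measurable g := by
    apply Measurable.indicator _ Metric.isOpen_ball.measurableSet
    exact ((measurable_indicator_disc hf.continuousOn).comp (measurable_const_add z)).enorm
  have h1 : ∫⁻ w in Metric.ball z R, ‖f w‖ₑ = ∫⁻ w, g w := by
    rw [← lintegral_indicator Metric.isOpen_ball.measurableSet,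
      ← lintegral_add_left_eq_self _ z]
    refine lintegral_congr fun w => ?_
    simp only [hg, Set.indicator]
    by_cases hw : ‖w‖ < R
    · have : z + w ∈ disc := hsub (by simpa using hw)
      simp [hw, this]
    · simp [hw]
  rw [h1, ← Complex.lintegral_comp_polarCoord_symm, polarCoord_target, Measure.volume_eq_prod,
    ← Measure.prod_restrict, lintegral_prod _ (by
      apply Measurable.aemeasurable
      simp only [smul_eq_mul]
      refine (ENNReal.measurable_ofReal.comp measurable_fst).mul (hgm.comp ?_)
      change Measurable fun p : ℝ × ℝ => Complex.polarCoord.symm p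
      simp_rw [Complex.polarCoord_symm_apply]
      fun_prop)]
  have h2 : ∫⁻ r in Set.Ioo 0 R, ENNReal.ofReal r * (‖f z‖ₑ * ENNReal.ofReal (2 * Real.pi)) =
      ‖f z‖ₑ * ENNReal.ofReal (Real.pi * R ^ 2) := by
    rw [lintegral_mul_const _ (by fun_prop),
      ← ofReal_integral_eq_lintegral_ofReal]
    · rw [← integral_Ioc_eq_integral_Ioo, ← intervalIntegral.integral_of_le hR0.le, integral_id,
        mul_left_comm, ← ENNReal.ofReal_mul (by simp; positivity)]
      congr 2; ring
    · exact (continuous_id.integrableOn_Icc).mono_set Set.Ioo_subset_Icc_self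
    · exact (ae_restrict_iff' measurableSet_Ioo).2 (Eventually.of_forall fun x hx => hx.1.le)
  rw [← h2]
  calc _ ≤ ∫⁻ r in Set.Ioo 0 R, ∫⁻ θ in Set.Ioo (-Real.pi) Real.pi,
        ENNReal.ofReal r • g (Complex.polarCoord.symm (r, θ)) := by
        refine setLIntegral_mono' measurableSet_Ioo fun r hr => ?_
        simp only [smul_eq_mul]
        refine le_trans ?_ (lintegral_const_mul_le _ _)
        gcongr
        refine (enorm_mul_two_pi_le_lintegral_circle hf hr.1 hr.2).trans (le_of_eq ?_)
        refine lintegral_congr fun θ => ?_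
        have hn : ‖(r : ℂ) * (Real.cos θ + Real.sin θ * Complex.I)‖ = r := by
          have := Complex.norm_polarCoord_symm (r, θ)
          rwa [Complex.polarCoord_symm_apply, abs_of_pos hr.1] at this
        have hb : z + (r : ℂ) * (Real.cos θ + Real.sin θ * Complex.I) ∈ disc :=
          hsub (by simp only [Metric.mem_ball, dist_self_add_left, hn]; exact hr.2)
        simp only [hg]
        rw [Complex.polarCoord_symm_apply, Set.indicator_of_mem (by
          simp only [Metric.mem_ball, dist_zero_right, hn]; exact hr.2), Set.indicator_of_mem hb]
    _ ≤ _ := lintegral_mono_set Set.Ioo_subset_Ioi_self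

/-- Functions of the Bergman space `A^q` grow at most like `(1 - |z|)^(-2/q)`. -/
lemma MemBergman.exists_norm_le {q : ℝ} (hq : 1 < q) {f : ℂ → ℂ} (hf : MemBergman q f) :
    ∃ C : ℝ, 0 ≤ C ∧ ∀ z ∈ disc, ‖f z‖ ≤ C * (1 - ‖z‖) ^ (-(2 / q)) := by
  have hq0 : 0 < q := by linarith
  set K := ∫⁻ z in disc, ‖f z‖ₑ ^ q with hK
  have hKt : K < ⊤ := hf.lintegral_lt_top hq0.le
  refine ⟨(K ^ (1 / q)).toReal * Real.pi ^ (-(1 / q)), by positivity, fun z hz => ?_⟩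
  have hz' := mem_disc.1 hz
  set R := 1 - ‖z‖ with hR
  have hR0 : 0 < R := by linarith
  have hsub : Metric.ball z R ⊆ disc := by
    intro w hw
    rw [Metric.mem_ball, dist_eq_norm] at hw
    rw [mem_disc]
    calc ‖w‖ = ‖(w - z) + z‖ := by simp
      _ ≤ ‖w - z‖ + ‖z‖ := norm_add_le _ _
      _ < 1 := by linarith
  have hdf : DifferentiableOn ℂ f disc := hf.1.differentiableOn
  have h1 := enorm_mul_volume_le_lintegral_ball hdf hz
  -- Hölder against the constant `1`: with `A = πR²` the area of the ball, dividing by `A` leaves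
  -- the factor `A ^ (-1/q)`.
  have hconj : q.HolderConjugate (q.conjExponent) := Real.HolderConjugate.conjExponent hq
  have h2 := ENNReal.lintegral_mul_le_Lp_mul_Lq (volume.restrict (Metric.ball z R)) hconj
    (f := fun w => ‖f w‖ₑ) (g := fun _ => 1)
    ((hdf.continuousOn.mono hsub).aestronglyMeasurable Metric.isOpen_ball.measurableSet).enorm
    aemeasurable_const
  simp only [Pi.mul_apply, mul_one, ENNReal.one_rpow, lintegral_one, Measure.restrict_apply_univ,
    Complex.volume_ball] at h2
  have hv : ENNReal.ofReal R ^ 2 * (NNReal.pi : ENNReal) = ENNReal.ofReal (Real.pi * R ^ 2) := by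
    rw [ENNReal.ofReal_mul Real.pi_pos.le, ENNReal.ofReal_pow hR0.le, mul_comm]
    congr 1
    rw [ENNReal.ofReal, Real.toNNReal_of_nonneg Real.pi_pos.le]; rfl
  rw [hv] at h2
  have h3 : (∫⁻ w in Metric.ball z R, ‖f w‖ₑ ^ q) ^ (1 / q) ≤ K ^ (1 / q) :=
    ENNReal.rpow_le_rpow (lintegral_mono_set hsub) (by positivity)
  set A := Real.pi * R ^ 2 with hA
  have hA0 : 0 < A := by positivity
  have h4 : ‖f z‖ₑ * ENNReal.ofReal A ≤
      K ^ (1 / q) * ENNReal.ofReal A ^ (1 / q.conjExponent) :=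
    h1.trans (h2.trans (by gcongr))
  have hKt' : K ^ (1 / q) ≠ ⊤ := ENNReal.rpow_ne_top_of_nonneg (by positivity) hKt.ne
  have h5 := ENNReal.toReal_mono (ENNReal.mul_ne_top hKt'
    (ENNReal.rpow_ne_top_of_nonneg hconj.symm.one_div_nonneg ENNReal.ofReal_ne_top)) h4
  rw [ENNReal.toReal_mul, ENNReal.toReal_mul, toReal_enorm, ← ENNReal.toReal_rpow (ENNReal.ofReal A),
    ENNReal.toReal_ofReal hA0.le] at h5
  have h6 : 1 / q.conjExponent = 1 - 1 / q := by
    have := hconj.inv_add_inv_eq_one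
    simp only [one_div]; linarith
  rw [h6, Real.rpow_sub hA0, Real.rpow_one, ← mul_div_assoc, mul_comm _ A, mul_comm _ A,
    mul_div_assoc, mul_le_mul_iff_right₀ hA0, div_eq_mul_inv, ← Real.rpow_neg hA0.le] at h5
  refine h5.trans (le_of_eq ?_)
  rw [hA, Real.mul_rpow Real.pi_pos.le (by positivity), ← mul_assoc, ← Real.rpow_natCast R 2,
    ← Real.rpow_mul hR0.le]
  congr 2
  push_cast; ring

/-! ### Growth of sums of Taylor coefficients -/

/-- The Taylor coefficients as circle averages. -/
lemma taylorCoeff_eq_circleAverage {f : ℂ → ℂ} (hf : DifferentiableOn ℂ f disc) {r : ℝ}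
    (hr : 0 < r) (hr1 : r < 1) (k : ℕ) :
    taylorCoeff f k = Real.circleAverage (fun z => z⁻¹ ^ k * f z) 0 r := by
  lift r to NNReal using hr.le
  have hsub : Metric.closedBall (0 : ℂ) r ⊆ disc := by
    intro w hw
    rw [mem_disc]
    rw [mem_closedBall_zero_iff] at hw
    linarith
  have hp := (hf.mono hsub).hasFPowerSeriesOnBall (by exact_mod_cast hr)
  have hq : HasFPowerSeriesAt f (FormalMultilinearSeries.ofScalars ℂ
      (fun n => iteratedDeriv n f 0 / (n.factorial : ℂ))) 0 :=
    AnalyticAt.hasFPowerSeriesAt (hf.analyticAt (isOpen_disc.mem_nhds (by simp [mem_disc])))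
  have he := hp.hasFPowerSeriesAt.eq_formalMultilinearSeries hq
  have h1 := congrArg (fun P => (P k) fun _ => (1 : ℂ)) he
  simp only [cauchyPowerSeries_apply] at h1
  rw [Real.circleAverage_eq_circleIntegral (by exact_mod_cast hr.ne')]
  simp only [FormalMultilinearSeries.ofScalars_apply_eq, one_pow, smul_eq_mul, mul_one] at h1
  rw [taylorCoeff, ← h1, smul_eq_mul]
  congr 2
  ext z
  simp [div_eq_mul_inv]
  ring

/-- The modulus of `1 - z` on a circle is bounded below by the half-angle sine. -/
lemma sin_half_le_norm_one_sub_circleMap {r : ℝ} (hr : 1 / 4 ≤ r) (θ : ℝ) :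
    |Real.sin (θ / 2)| ≤ ‖1 - circleMap 0 r θ‖ := by
  rw [Complex.norm_def]
  apply Real.le_sqrt_of_sq_le
  have h1 : Complex.normSq (1 - circleMap 0 r θ) =
      (1 - r * Real.cos θ) ^ 2 + (r * Real.sin θ) ^ 2 := by
    rw [Complex.normSq_apply]
    simp [circleMap, Complex.exp_re, Complex.exp_im]
    ring
  have hc : Real.cos θ = 1 - 2 * Real.sin (θ / 2) ^ 2 := by
    have := Real.cos_two_mul (θ / 2)
    rw [show 2 * (θ / 2) = θ by ring, Real.cos_sq'] at this
    linarith
  rw [h1, sq_abs]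
  -- In this form `1/4 ≤ r` makes the coefficient `4 r` of the squared sine at least `1`.
  have h2 : (1 - r * Real.cos θ) ^ 2 + (r * Real.sin θ) ^ 2 =
      (1 - r) ^ 2 + 4 * r * Real.sin (θ / 2) ^ 2 := by
    have := Real.sin_sq_add_cos_sq θ
    calc _ = 1 - 2 * r * Real.cos θ + r ^ 2 * (Real.sin θ ^ 2 + Real.cos θ ^ 2) := by ring
      _ = _ := by rw [this, hc]; ring
  rw [h2]
  nlinarith [sq_nonneg (1 - r), sq_nonneg (Real.sin (θ / 2))]

/-- The kernel `1 / |1 - z|` on a circle is controlled by an integrable function of the angle, at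
the cost of an arbitrarily small power of `1 - r`. -/
lemma inv_norm_one_sub_circleMap_le {r : ℝ} (hr : 1 / 4 ≤ r) (hr1 : r < 1) {δ : ℝ} (hδ : 0 < δ)
    (hδ1 : δ < 1) {θ : ℝ} (hθ : 0 < θ) (hθ1 : θ < 2 * Real.pi) :
    ‖1 - circleMap 0 r θ‖⁻¹ ≤ (1 - r) ^ (-δ) *
      ((θ / Real.pi) ^ (δ - 1) + ((2 * Real.pi - θ) / Real.pi) ^ (δ - 1)) := by
  set X := ‖1 - circleMap 0 r θ‖
  have hπ := Real.pi_pos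
  have hX1 : 1 - r ≤ X := by
    have := norm_sub_norm_le (1 : ℂ) (circleMap 0 r θ)
    rw [norm_one, norm_circleMap_zero, abs_of_pos (by linarith)] at this
    exact this
  have hX0 : 0 < X := by linarith
  have hX2 := sin_half_le_norm_one_sub_circleMap hr θ
  -- The first factor is bounded through `1 - r ≤ X`, the second through the angle, where the
  -- exponent `δ - 1` is integrable.
  have h1 : X⁻¹ = X ^ (-δ) * X ^ (δ - 1) := by
    rw [← Real.rpow_add hX0, ← Real.rpow_neg_one]; congr 1; ring
  rw [h1]
  have ha : 0 ≤ (θ / Real.pi) ^ (δ - 1) := by positivity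
  have hb : 0 ≤ ((2 * Real.pi - θ) / Real.pi) ^ (δ - 1) :=
    Real.rpow_nonneg (div_nonneg (by linarith) hπ.le) _
  apply mul_le_mul _ _ (by positivity) (Real.rpow_nonneg (by linarith) _)
  · exact Real.rpow_le_rpow_of_nonpos (by linarith) hX1 (by linarith)
  rcases le_total θ Real.pi with h | h
  · have h2 := Real.mul_le_sin (x := θ / 2) (by linarith) (by linarith)
    have h3 : θ / Real.pi ≤ X := by
      refine le_trans ?_ ((le_abs_self _).trans hX2)
      refine le_trans (le_of_eq ?_) h2
      field_simp
    have := Real.rpow_le_rpow_of_nonpos (z := δ - 1) (by positivity) h3 (by linarith)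
    linarith
  · have h2 := Real.mul_le_sin (x := Real.pi - θ / 2) (by linarith) (by linarith)
    rw [Real.sin_pi_sub] at h2
    have h3 : (2 * Real.pi - θ) / Real.pi ≤ X := by
      refine le_trans ?_ ((le_abs_self _).trans hX2)
      refine le_trans (le_of_eq ?_) h2
      field_simp
    have := Real.rpow_le_rpow_of_nonpos (z := δ - 1) (div_pos (by linarith) hπ) h3 (by linarith)
    linarith

lemma intervalIntegrable_angle_majorant {δ : ℝ} (hδ : 0 < δ) :
    IntervalIntegrable (fun θ : ℝ => (θ / Real.pi) ^ (δ - 1) +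
      ((2 * Real.pi - θ) / Real.pi) ^ (δ - 1)) volume 0 (2 * Real.pi) := by
  have hb : IntervalIntegrable (fun x : ℝ => x ^ (δ - 1)) volume 0 2 :=
    intervalIntegral.intervalIntegrable_rpow' (by linarith)
  have hπ := Real.pi_pos
  have h1 : IntervalIntegrable (fun θ : ℝ => (θ / Real.pi) ^ (δ - 1)) volume 0 (2 * Real.pi) := by
    have := hb.comp_mul_left (c := Real.pi⁻¹)
    simp only [div_inv_eq_mul] at this
    simpa [div_eq_inv_mul] using this
  refine h1.add ?_
  have := (h1.comp_sub_left (2 * Real.pi)).symm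
  simpa using this

/-- A geometric sum in `1/z` on a circle. -/
lemma norm_sum_inv_pow_le {z : ℂ} (hz0 : z ≠ 0) (hz : ‖z‖ < 1) (n : ℕ) :
    ‖∑ k ∈ Finset.range (n + 1), z⁻¹ ^ k‖ ≤ 2 * ‖z‖⁻¹ ^ n * ‖1 - z‖⁻¹ := by
  have h1 : z ≠ 1 := by rintro rfl; simp at hz
  have h1' : 1 - z ≠ 0 := sub_ne_zero.2 h1.symm
  have hr : 0 < ‖z‖ := norm_pos_iff.2 hz0
  have h2 : ∑ k ∈ Finset.range (n + 1), z⁻¹ ^ k = (z⁻¹ ^ n - z) * (1 - z)⁻¹ := by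
    rw [geom_sum_eq (by simpa using h1)]
    have : z⁻¹ - 1 ≠ 0 := by
      rw [sub_ne_zero]; simpa using h1
    rw [div_eq_iff this, pow_succ]
    field_simp
  rw [h2, norm_mul, norm_inv]
  gcongr
  refine (norm_sub_le _ _).trans ?_
  rw [norm_pow, norm_inv]
  have : 1 ≤ ‖z‖⁻¹ ^ n := one_le_pow₀ (one_le_inv_iff₀.2 ⟨hr, hz.le⟩)
  linarith

/-- Partial sums of the Taylor coefficients of a function of power growth. -/
lemma exists_norm_sum_taylorCoeff_le {f : ℂ → ℂ} (hf : DifferentiableOn ℂ f disc) {b C δ : ℝ}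
    (hb : 0 ≤ b) (hC : 0 ≤ C) (hfC : ∀ z ∈ disc, ‖f z‖ ≤ C * (1 - ‖z‖) ^ (-b)) (hδ : 0 < δ)
    (hδ1 : δ < 1) :
    ∃ D : ℝ, 0 ≤ D ∧ ∀ n : ℕ, ‖∑ k ∈ Finset.range (n + 1), taylorCoeff f k‖ ≤
      D * ((n : ℝ) + 1) ^ (b + δ) := by
  set h : ℝ → ℝ := fun θ => (θ / Real.pi) ^ (δ - 1) +
      ((2 * Real.pi - θ) / Real.pi) ^ (δ - 1) with hh
  have hπ := Real.pi_pos
  have hI : 0 ≤ ∫ θ in (0 : ℝ)..(2 * Real.pi), h θ := by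
    apply intervalIntegral.integral_nonneg (by positivity)
    intro θ hθ
    have : 0 ≤ 2 * Real.pi - θ := by linarith [hθ.2]
    have := hθ.1
    positivity
  refine ⟨(2 * Real.pi)⁻¹ * (C * 2 * Real.exp 1 * 2 ^ (b + δ) *
    ∫ θ in (0 : ℝ)..(2 * Real.pi), h θ), by positivity, fun n => ?_⟩
  have hn : (0 : ℝ) < (n : ℝ) + 1 := by positivity
  -- With `1 - r = 1 / (n + 2)` the factor `r⁻¹ ^ n` stays below `e`, while powers of `1 - r` become
  -- powers of `n`.
  set r : ℝ := ((n : ℝ) + 1) / (n + 2) with hr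
  have hr0 : 0 < r := by positivity
  have hr1 : 1 - r = ((n : ℝ) + 2)⁻¹ := by rw [hr]; field_simp; ring
  have hr1' : r < 1 := by
    have : 0 < 1 - r := by rw [hr1]; positivity
    linarith
  have hr4 : 1 / 4 ≤ r := by
    rw [hr, div_le_div_iff₀ (by norm_num) (by positivity)]; linarith
  have hmem : ∀ θ, circleMap 0 r θ ∈ disc := fun θ => by
    rw [mem_disc, norm_circleMap_zero, abs_of_pos hr0]; exact hr1'
  have hne : ∀ θ, circleMap 0 r θ ≠ 0 := fun θ => by simpa using hr0.ne'
  have hcont : Continuous fun θ => f (circleMap 0 r θ) :=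
    hf.continuousOn.comp_continuous (continuous_circleMap 0 r) hmem
  have hsum : ∑ k ∈ Finset.range (n + 1), taylorCoeff f k = (2 * Real.pi)⁻¹ •
      ∫ θ in (0 : ℝ)..(2 * Real.pi),
        (∑ k ∈ Finset.range (n + 1), (circleMap 0 r θ)⁻¹ ^ k) * f (circleMap 0 r θ) := by
    simp_rw [taylorCoeff_eq_circleAverage hf hr0 hr1', Real.circleAverage_def, Finset.sum_mul]
    rw [intervalIntegral.integral_finsetSum, Finset.smul_sum]
    intro k _
    apply Continuous.intervalIntegrable
    exact (((continuous_circleMap 0 r).inv₀ hne).pow k).mul hcont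
  have hexp : r⁻¹ ^ n ≤ Real.exp 1 := by
    have h1 : r⁻¹ = 1 / ((n : ℝ) + 1) + 1 := by rw [hr]; field_simp; ring
    calc r⁻¹ ^ n ≤ (Real.exp (1 / ((n : ℝ) + 1))) ^ n := by
          gcongr; rw [h1]; exact Real.add_one_le_exp _
      _ = Real.exp (n * (1 / ((n : ℝ) + 1))) := by rw [← Real.exp_nat_mul]
      _ ≤ Real.exp 1 := by
          apply Real.exp_le_exp.2
          rw [mul_one_div, div_le_one hn]; linarith
  have hpw : (1 - r) ^ (-b) * (1 - r) ^ (-δ) ≤ 2 ^ (b + δ) * ((n : ℝ) + 1) ^ (b + δ) := by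
    rw [← Real.rpow_add (by linarith), hr1, Real.inv_rpow (by positivity), ← Real.rpow_neg
      (by positivity), ← Real.mul_rpow (by norm_num) hn.le,
      show -(-b + -δ) = b + δ by ring]
    apply Real.rpow_le_rpow (by positivity) (by linarith) (by linarith)
  have hbound : ∀ θ ∈ Set.Ioo 0 (2 * Real.pi),
      ‖(∑ k ∈ Finset.range (n + 1), (circleMap 0 r θ)⁻¹ ^ k) * f (circleMap 0 r θ)‖ ≤
        C * 2 * Real.exp 1 * 2 ^ (b + δ) * ((n : ℝ) + 1) ^ (b + δ) * h θ := by
    intro θ hθ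
    have e1 := norm_sum_inv_pow_le (hne θ) (mem_disc.1 (hmem θ)) n
    have e2 := hfC _ (hmem θ)
    have e3 := inv_norm_one_sub_circleMap_le hr4 hr1' hδ hδ1 hθ.1 hθ.2
    rw [norm_circleMap_zero, abs_of_pos hr0] at e1 e2
    have hh0 : 0 ≤ h θ := by
      have : 0 ≤ 2 * Real.pi - θ := by linarith [hθ.2]
      have := hθ.1
      positivity
    have hr' : 0 ≤ 1 - r := by linarith
    rw [norm_mul]
    calc _ ≤ (2 * r⁻¹ ^ n * ‖1 - circleMap 0 r θ‖⁻¹) * (C * (1 - r) ^ (-b)) := by gcongr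
      _ ≤ (2 * Real.exp 1 * ((1 - r) ^ (-δ) * h θ)) * (C * (1 - r) ^ (-b)) := by gcongr
      _ = (C * 2 * Real.exp 1 * h θ) * ((1 - r) ^ (-b) * (1 - r) ^ (-δ)) := by ring
      _ ≤ (C * 2 * Real.exp 1 * h θ) * (2 ^ (b + δ) * ((n : ℝ) + 1) ^ (b + δ)) := by gcongr
      _ = _ := by ring
  rw [hsum, norm_smul, Real.norm_of_nonneg (by positivity), mul_assoc]
  gcongr
  refine (intervalIntegral.norm_integral_le_of_norm_le (g := fun θ =>
    C * 2 * Real.exp 1 * 2 ^ (b + δ) * ((n : ℝ) + 1) ^ (b + δ) * h θ) (by positivity) ?_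
    ((intervalIntegrable_angle_majorant hδ).const_mul _)).trans (le_of_eq ?_)
  -- At `2π` the singular term of `h` takes the default value `0 ^ (δ - 1) = 0`, so this null point
  -- is left out.
  · filter_upwards [Measure.ae_ne volume (2 * Real.pi)] with θ hθ1 hθ
    exact hbound θ ⟨hθ.1, lt_of_le_of_ne hθ.2 hθ1⟩
  · rw [intervalIntegral.integral_const_mul]; ring

/-! ### Abel summation -/

/-- The `l`-th partial sum of the power series with coefficients `a`. -/
def partialSum (a : ℕ → ℂ) (l : ℕ) (w : ℂ) : ℂ :=
  ∑ k ∈ Finset.range (l + 1), a k * w ^ k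

lemma continuous_partialSum (a : ℕ → ℂ) (l : ℕ) : Continuous (partialSum a l) := by
  unfold partialSum; fun_prop

lemma differentiable_partialSum (a : ℕ → ℂ) (l : ℕ) : Differentiable ℂ (partialSum a l) := by
  unfold partialSum; fun_prop

/-- Abel summation. -/
lemma partialSum_eq_abel (a : ℕ → ℂ) (l : ℕ) (w : ℂ) :
    partialSum a l w = (1 - w) * ∑ n ∈ Finset.range l, partialSum a n 1 * w ^ n +
      partialSum a l 1 * w ^ l := by
  induction l with
  | zero => simp [partialSum]
  | succ l ih =>
    have h (v : ℂ) : partialSum a (l + 1) v = partialSum a l v + a (l + 1) * v ^ (l + 1) :=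
      Finset.sum_range_succ _ _
    rw [h, ih, Finset.sum_range_succ, h 1]
    ring

/-- The truncated series for `(1 - x)⁻²`. For `0 ≤ x ≤ 1` the subtracted term is nonnegative, which
gives bounds uniform in `l`. -/
lemma mul_sum_succ_mul_pow (x : ℝ) (l : ℕ) :
    (1 - x) ^ 2 * ∑ n ∈ Finset.range l, ((n : ℝ) + 1) * x ^ n = 1 - x ^ l * (1 + l * (1 - x)) := by
  induction l with
  | zero => simp
  | succ l ih => rw [Finset.sum_range_succ, mul_add, ih]; push_cast; ring

lemma mul_sum_pow (x : ℝ) (l : ℕ) :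
    (1 - x) * ∑ n ∈ Finset.range l, x ^ n = 1 - x ^ l := by
  rw [mul_comm]; exact geom_sum_mul_neg x l

/-- For `v = u * y` this is `v ^ β ≤ 1 + v`. It replaces `(n + 1) ^ β` by an affine function of `n`,
which can be summed exactly against `x ^ n`. -/
lemma rpow_le_rpow_neg_mul {u y β : ℝ} (hu : 0 ≤ u) (hy : 0 < y) (hβ : 0 ≤ β) (hβ1 : β ≤ 1) :
    u ^ β ≤ y ^ (-β) * (1 + u * y) := by
  have h1 : (u * y) ^ β ≤ 1 + u * y := by
    rcases le_total (u * y) 1 with h | h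
    · exact (Real.rpow_le_one (by positivity) h hβ).trans (by nlinarith)
    · calc _ ≤ (u * y) ^ (1 : ℝ) := Real.rpow_le_rpow_of_exponent_le h hβ1
        _ ≤ _ := by rw [Real.rpow_one]; linarith
  calc u ^ β = y ^ (-β) * (u * y) ^ β := by
        rw [Real.mul_rpow hu hy.le, Real.rpow_neg hy.le]
        have : y ^ β ≠ 0 := (Real.rpow_pos_of_pos hy _).ne'
        field_simp
    _ ≤ _ := by gcongr

/-- Partial sums of a power series whose values at `1` have power growth. -/
lemma norm_partialSum_le {a : ℕ → ℂ} {D β : ℝ} (hD : 0 ≤ D) (hβ : 0 ≤ β) (hβ1 : β ≤ 1)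
    (ha : ∀ n : ℕ, ‖partialSum a n 1‖ ≤ D * ((n : ℝ) + 1) ^ β) (l : ℕ) {w : ℂ} (hw : ‖w‖ < 1) :
    ‖partialSum a l w‖ ≤
      2 * D * (1 - ‖w‖) ^ (-β) * (‖1 - w‖ * (1 - ‖w‖)⁻¹ + 1) := by
  set x := ‖w‖ with hx
  have hx0 : 0 ≤ x := norm_nonneg _
  set y := 1 - x with hy
  have hy0 : 0 < y := by linarith
  have hxl (n : ℕ) : 0 ≤ x ^ n := by positivity
  have hterm (n : ℕ) : ‖partialSum a n 1 * w ^ n‖ ≤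
      D * y ^ (-β) * (x ^ n + y * (((n : ℝ) + 1) * x ^ n)) := by
    rw [norm_mul, norm_pow]
    calc _ ≤ (D * (y ^ (-β) * (1 + ((n : ℝ) + 1) * y))) * x ^ n := by
          gcongr
          exact (ha n).trans (mul_le_mul_of_nonneg_left
            (rpow_le_rpow_neg_mul (by positivity) hy0 hβ hβ1) hD)
      _ = _ := by ring
  have e1 := mul_sum_pow x l
  have e2 := mul_sum_succ_mul_pow x l
  rw [← hy] at e1 e2
  have hP : 0 ≤ D * y ^ (-β) := by positivity
  have h1 : ‖∑ n ∈ Finset.range l, partialSum a n 1 * w ^ n‖ ≤ D * y ^ (-β) * (2 * y⁻¹) := by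
    refine (norm_sum_le_of_le _ fun n _ => hterm n).trans ?_
    rw [← Finset.mul_sum, Finset.sum_add_distrib, ← Finset.mul_sum]
    apply mul_le_mul_of_nonneg_left _ hP
    rw [← div_eq_mul_inv, le_div_iff₀ hy0]
    have := hxl l
    have : 0 ≤ x ^ l * (1 + l * y) := by positivity
    nlinarith
  have h2 : ‖partialSum a l 1 * w ^ l‖ ≤ D * y ^ (-β) * 2 := by
    refine (hterm l).trans (mul_le_mul_of_nonneg_left ?_ hP)
    -- By `e2` this says `x ^ l * (1 + l * y) ≤ 1`; the remaining `y * x ^ l` is at most `1`, whence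
    -- the constant `2`.
    have h3 : 0 ≤ y ^ 2 * ∑ n ∈ Finset.range l, ((n : ℝ) + 1) * x ^ n := by positivity
    have h4 : x ^ l ≤ 1 := pow_le_one₀ hx0 hw.le
    have h5 : y * x ^ l ≤ 1 := by nlinarith [hxl l]
    nlinarith
  rw [partialSum_eq_abel]
  calc _ ≤ ‖1 - w‖ * (D * y ^ (-β) * (2 * y⁻¹)) + D * y ^ (-β) * 2 := by
        refine (norm_add_le _ _).trans (add_le_add ?_ h2)
        rw [norm_mul]
        gcongr
    _ = _ := by ring

/-! ### Geometry of the path -/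

/-- The path from `0` to `1` in the disc along which `∫ f(s) / (1 - s z) ds` is evaluated. -/
def diskPath (t : ℝ) (z : ℂ) : ℂ := t / (1 - (1 - t) * z)

lemma norm_one_sub_mul_ge {t : ℝ} (ht : t ≤ 1) (z : ℂ) :
    1 - (1 - t) * ‖z‖ ≤ ‖1 - (1 - t : ℂ) * z‖ := by
  have := norm_sub_norm_le (1 : ℂ) ((1 - t : ℂ) * z)
  have h1 : ‖(1 - t : ℂ)‖ = 1 - t := by
    rw [← Complex.ofReal_one, ← Complex.ofReal_sub, Complex.norm_real,
      Real.norm_of_nonneg (by linarith)]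
  rwa [norm_one, norm_mul, h1] at this

lemma norm_one_sub_mul_le {t : ℝ} (ht : t ≤ 1) (z : ℂ) :
    ‖1 - (1 - t : ℂ) * z‖ ≤ 1 + (1 - t) * ‖z‖ := by
  have := norm_sub_le (1 : ℂ) ((1 - t : ℂ) * z)
  have h1 : ‖(1 - t : ℂ)‖ = 1 - t := by
    rw [← Complex.ofReal_one, ← Complex.ofReal_sub, Complex.norm_real,
      Real.norm_of_nonneg (by linarith)]
  rwa [norm_one, norm_mul, h1] at this

lemma one_sub_norm_le_norm_one_sub_mul {t : ℝ} (ht0 : 0 ≤ t) (ht : t ≤ 1) (z : ℂ) :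
    1 - ‖z‖ ≤ ‖1 - (1 - t : ℂ) * z‖ := by
  have := norm_one_sub_mul_ge ht z
  nlinarith [norm_nonneg z]

lemma le_norm_one_sub_mul {t : ℝ} (ht : t ≤ 1) {z : ℂ} (hz : ‖z‖ < 1) :
    t ≤ ‖1 - (1 - t : ℂ) * z‖ := by
  have := norm_one_sub_mul_ge ht z
  nlinarith [norm_nonneg z]

lemma one_sub_mul_ne_zero {t : ℝ} (ht0 : 0 ≤ t) (ht : t ≤ 1) {z : ℂ} (hz : ‖z‖ < 1) :
    1 - (1 - t : ℂ) * z ≠ 0 := by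
  have := one_sub_norm_le_norm_one_sub_mul ht0 ht z
  rw [← norm_pos_iff]; linarith

lemma norm_diskPath {t : ℝ} (ht0 : 0 ≤ t) (z : ℂ) :
    ‖diskPath t z‖ = t / ‖1 - (1 - t : ℂ) * z‖ := by
  rw [diskPath, norm_div, Complex.norm_real, Real.norm_of_nonneg ht0]

lemma one_sub_diskPath {t : ℝ} (ht0 : 0 ≤ t) (ht : t ≤ 1) {z : ℂ} (hz : ‖z‖ < 1) :
    1 - diskPath t z = (1 - t) * (1 - z) / (1 - (1 - t) * z) := by
  have := one_sub_mul_ne_zero ht0 ht hz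
  rw [diskPath, eq_div_iff this, sub_mul, div_mul_cancel₀ _ this]
  ring

/-- The denominator exceeds `t` by at least `(1 - t) * (1 - ‖z‖)` and is at most `2`. Together with
`norm_one_sub_diskPath_le`, for fixed `z` the path tends to `1` inside a Stolz angle, so Abel
summation loses only a constant. -/
lemma le_one_sub_norm_diskPath {t : ℝ} (ht0 : 0 ≤ t) (ht : t ≤ 1) {z : ℂ} (hz : ‖z‖ < 1) :
    (1 - t) * ((1 - ‖z‖) / 2) ≤ 1 - ‖diskPath t z‖ := by
  have h1 := norm_one_sub_mul_ge ht z
  have h2 := norm_one_sub_mul_le ht z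
  have h0 := norm_pos_iff.2 (one_sub_mul_ne_zero ht0 ht hz)
  rw [norm_diskPath ht0, one_sub_div h0.ne', le_div_iff₀ h0]
  set d := ‖1 - (1 - t : ℂ) * z‖
  have h3 : d ≤ 2 := by nlinarith [norm_nonneg z]
  have h4 : 0 ≤ (1 - t) * ((1 - ‖z‖) / 2) := mul_nonneg (by linarith) (by linarith)
  nlinarith

lemma diskPath_mem_disc {t : ℝ} (ht0 : 0 ≤ t) (ht : t < 1) {z : ℂ} (hz : ‖z‖ < 1) :
    diskPath t z ∈ disc := by
  rw [mem_disc]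
  have h1 := le_one_sub_norm_diskPath ht0 ht.le hz
  have : 0 < (1 - t) * ((1 - ‖z‖) / 2) := mul_pos (by linarith) (by linarith)
  linarith

lemma norm_diskPath_le_one {t : ℝ} (ht0 : 0 ≤ t) (ht : t ≤ 1) {z : ℂ} (hz : ‖z‖ < 1) :
    ‖diskPath t z‖ ≤ 1 := by
  have h1 := le_one_sub_norm_diskPath ht0 ht hz
  have : 0 ≤ (1 - t) * ((1 - ‖z‖) / 2) := mul_nonneg (by linarith) (by linarith)
  linarith

lemma norm_one_sub_diskPath_le {t : ℝ} (ht0 : 0 ≤ t) (ht : t ≤ 1) {z : ℂ} (hz : ‖z‖ < 1) :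
    ‖1 - diskPath t z‖ ≤ (1 - t) * (2 / (1 - ‖z‖)) := by
  rw [one_sub_diskPath ht0 ht hz, norm_div, norm_mul]
  have h1 : ‖(1 - t : ℂ)‖ = 1 - t := by
    rw [← Complex.ofReal_one, ← Complex.ofReal_sub, Complex.norm_real,
      Real.norm_of_nonneg (by linarith)]
  have h2 : ‖1 - z‖ ≤ 2 := (norm_sub_le _ _).trans (by rw [norm_one]; linarith)
  rw [h1, mul_div_assoc]
  have h3 := one_sub_norm_le_norm_one_sub_mul ht0 ht z
  have h4 : 0 < 1 - ‖z‖ := by linarith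
  gcongr

/-- Uniform majorant of the partial sums along the path. -/
lemma exists_norm_partialSum_diskPath_le {a : ℕ → ℂ} {D β : ℝ} (hD : 0 ≤ D) (hβ : 0 ≤ β)
    (hβ1 : β ≤ 1) (ha : ∀ n : ℕ, ‖partialSum a n 1‖ ≤ D * ((n : ℝ) + 1) ^ β) {z : ℂ}
    (hz : ‖z‖ < 1) :
    ∃ E : ℝ, 0 ≤ E ∧ ∀ (l : ℕ) (t : ℝ), 0 ≤ t → t < 1 →
      ‖partialSum a l (diskPath t z)‖ ≤ E * (1 - t) ^ (-β) := by
  have hd : 0 < 1 - ‖z‖ := by linarith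
  refine ⟨2 * D * ((1 - ‖z‖) / 2) ^ (-β) * (4 / (1 - ‖z‖) ^ 2 + 1), by positivity,
    fun l t ht0 ht => ?_⟩
  have hu : 0 < 1 - t := by linarith
  have h1 := le_one_sub_norm_diskPath ht0 ht.le hz
  have h2 := norm_one_sub_diskPath_le ht0 ht.le hz
  have h3 : 0 < (1 - t) * ((1 - ‖z‖) / 2) := by positivity
  refine (norm_partialSum_le hD hβ hβ1 ha l (mem_disc.1 (diskPath_mem_disc ht0 ht hz))).trans ?_
  calc _ ≤ 2 * D * ((1 - t) * ((1 - ‖z‖) / 2)) ^ (-β) *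
        ((1 - t) * (2 / (1 - ‖z‖)) * ((1 - t) * ((1 - ‖z‖) / 2))⁻¹ + 1) := by
        have h4 := h3.trans_le h1
        have := Real.rpow_le_rpow_of_nonpos h3 h1 (neg_nonpos.2 hβ)
        gcongr
    _ = _ := by
        rw [Real.mul_rpow hu.le (by positivity)]
        field_simp
        ring

lemma diskPath_zero_right (t : ℝ) : diskPath t 0 = t := by simp [diskPath]

lemma continuousOn_diskPath {z : ℂ} (hz : ‖z‖ < 1) :
    ContinuousOn (fun t : ℝ => diskPath t z) (Set.Icc 0 1) := by
  unfold diskPath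
  exact ContinuousOn.div (by fun_prop) (by fun_prop) fun t ht => one_sub_mul_ne_zero ht.1 ht.2 hz

lemma continuousOn_inv_one_sub_mul {z : ℂ} (hz : ‖z‖ < 1) :
    ContinuousOn (fun t : ℝ => (1 - (1 - t : ℂ) * z)⁻¹) (Set.Icc 0 1) :=
  ContinuousOn.inv₀ (by fun_prop) fun t ht => one_sub_mul_ne_zero ht.1 ht.2 hz

/-! ### Moment integrals and path independence -/

lemma integral_zero_one_pow (n : ℕ) :
    ∫ t in (0 : ℝ)..1, (t : ℂ) ^ n = ((1 / ((n : ℝ) + 1) : ℝ) : ℂ) := by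
  have h : (fun t : ℝ => (t : ℂ) ^ n) = fun t => ((t ^ n : ℝ) : ℂ) := by
    ext t; push_cast; rfl
  rw [h, intervalIntegral.integral_ofReal, integral_pow]
  simp

/-- The partial sums of the multiple series are moments of powers of partial sums. -/
lemma hilbertPartialSum_eq_integral (m : ℕ) (a : ℕ → ℂ) (k l : ℕ) :
    hilbertPartialSum m a k l = ∫ t in (0 : ℝ)..1, (t : ℂ) ^ k * partialSum a l t ^ (m - 1) := by
  unfold hilbertPartialSum
  generalize m - 1 = N
  have h (t : ℝ) : (t : ℂ) ^ k * partialSum a l t ^ N =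
      ∑ i ∈ Fintype.piFinset (fun _ : Fin N => Finset.range (l + 1)),
        (∏ r, a (i r)) * (t : ℂ) ^ (k + ∑ r, i r) := by
    have h1 : partialSum a l t ^ N =
        ∏ _r : Fin N, ∑ j ∈ Finset.range (l + 1), a j * (t : ℂ) ^ j := by
      simp [partialSum]
    rw [h1, Finset.prod_univ_sum, Finset.mul_sum]
    refine Finset.sum_congr rfl fun i _ => ?_
    rw [Finset.prod_mul_distrib, Finset.prod_pow_eq_pow_sum, pow_add]
    ring
  simp_rw [h]
  rw [intervalIntegral.integral_finsetSum fun i _ => Continuous.intervalIntegrable (by fun_prop) _ _]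
  refine Finset.sum_congr rfl fun i _ => ?_
  have h2 : hilbertTensor (N + 1) (Fin.cons k i) = 1 / (((k + ∑ r, i r : ℕ) : ℝ) + 1) := by
    rw [hilbertTensor, Fin.sum_univ_succ]
    simp only [Fin.cons_zero, Fin.cons_succ]
  rw [intervalIntegral.integral_const_mul, integral_zero_one_pow, h2, mul_comm]

lemma intervalIntegrable_one_sub_rpow {s : ℝ} (hs : -1 < s) :
    IntervalIntegrable (fun t : ℝ => (1 - t) ^ s) volume 0 1 := by
  have := ((intervalIntegral.intervalIntegrable_rpow' hs (a := 0) (b := 1)).comp_sub_left 1).symm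
  simpa using this

/-- At `t = 1` the path reaches the boundary point `1`, where `f` is arbitrary; that point is null.
-/
lemma ae_uIoc_zero_one {P : ℝ → Prop} (h : ∀ t, 0 ≤ t → t < 1 → P t) :
    ∀ᵐ t : ℝ, t ∈ Set.uIoc (0 : ℝ) 1 → P t := by
  filter_upwards [Measure.ae_ne volume (1 : ℝ)] with t ht1 ht
  rw [Set.uIoc_of_le zero_le_one] at ht
  exact h t ht.1.le (lt_of_le_of_ne ht.2 ht1)

/-- Path independence of `∫ P(s) / (1 - s z) ds`. -/
lemma integral_div_one_sub_mul_eq_diskPath {P : ℂ → ℂ} (hP : Differentiable ℂ P) {z : ℂ}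
    (hz : ‖z‖ < 1) :
    ∫ t in (0 : ℝ)..1, P t / (1 - t * z) =
      ∫ t in (0 : ℝ)..1, (1 - (1 - t : ℂ) * z)⁻¹ * P (diskPath t z) := by
  -- Any `R` with `1 < R` and `R * ‖z‖ < 1` would do: the ball contains both paths but not the pole
  -- `1/z`.
  set R : ℝ := 2 / (1 + ‖z‖) with hR
  have hz0 := norm_nonneg z
  have hR1 : 1 < R := by rw [hR, lt_div_iff₀ (by positivity)]; linarith
  have hRz : R * ‖z‖ < 1 := by
    rw [hR, div_mul_eq_mul_div, div_lt_one (by positivity)]; linarith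
  have hne : ∀ w ∈ Metric.ball (0 : ℂ) R, 1 - w * z ≠ 0 := by
    intro w hw h
    rw [mem_ball_zero_iff] at hw
    have h1 : ‖w * z‖ = 1 := by rw [← sub_eq_zero.1 h, norm_one]
    rw [norm_mul] at h1
    nlinarith
  have hd : DifferentiableOn ℂ (fun w => P w / (1 - w * z)) (Metric.ball 0 R) :=
    DifferentiableOn.div hP.differentiableOn (by fun_prop) hne
  -- Both integrals equal `G 1 - G 0` for a primitive `G` on the ball.
  obtain ⟨G, hG⟩ := hd.isExactOn_ball
  have hI1 (t : ℝ) (ht : t ∈ Set.uIcc (0 : ℝ) 1) : (t : ℂ) ∈ Metric.ball (0 : ℂ) R := by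
    rw [Set.uIcc_of_le zero_le_one] at ht
    rw [mem_ball_zero_iff, Complex.norm_real, Real.norm_of_nonneg ht.1]
    linarith [ht.2]
  have hI2 (t : ℝ) (ht : t ∈ Set.uIcc (0 : ℝ) 1) : diskPath t z ∈ Metric.ball (0 : ℂ) R := by
    rw [Set.uIcc_of_le zero_le_one] at ht
    rw [mem_ball_zero_iff]
    linarith [norm_diskPath_le_one ht.1 ht.2 hz]
  rw [intervalIntegral.integral_eq_sub_of_hasDerivAt (f := fun t : ℝ => G t)
    (fun t ht => (hG t (hI1 t ht)).comp_ofReal)]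
  swap
  · apply ContinuousOn.intervalIntegrable
    exact hd.continuousOn.comp (by fun_prop) hI1
  rw [intervalIntegral.integral_eq_sub_of_hasDerivAt (f := fun t : ℝ => G (diskPath t z))]
  · simp [diskPath]
  · intro t ht
    have h1 := hG _ (hI2 t ht)
    have h3 := hne _ (hI2 t ht)
    rw [Set.uIcc_of_le zero_le_one] at ht
    have hden := one_sub_mul_ne_zero ht.1 ht.2 hz
    have h2 : HasDerivAt (fun s : ℂ => s / (1 - (1 - s) * z))
        ((1 - z) / (1 - (1 - t : ℂ) * z) ^ 2) (t : ℂ) := by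
      have hD : HasDerivAt (fun s : ℂ => 1 - (1 - s) * z) z (t : ℂ) := by
        have := (((hasDerivAt_id (t : ℂ)).const_sub 1).mul_const z).const_sub 1
        simpa using this
      refine ((hasDerivAt_id (t : ℂ)).div hD hden).congr_deriv ?_
      simp only [id]
      congr 1; ring
    have h4 := (HasDerivAt.comp (t : ℂ) (by exact h1) h2).comp_ofReal
    refine h4.congr_deriv ?_
    -- Dividing the path's velocity `(1 - z) / (1 - (1 - t) z)²` by this quantity leaves exactly the
    -- weight `ω_t(z)`.
    have h5 : 1 - diskPath t z * z = (1 - z) / (1 - (1 - t) * z) := by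
      rw [eq_div_iff hden, diskPath, sub_mul, div_mul_eq_mul_div, div_mul_cancel₀ _ hden]
      ring
    have h6 : 1 - z ≠ 0 := sub_ne_zero.2 (by rintro rfl; simp at hz)
    simp only [h5]
    field_simp
  · apply ContinuousOn.intervalIntegrable
    rw [Set.uIcc_of_le zero_le_one]
    exact (continuousOn_inv_one_sub_mul hz).mul
      (hP.continuous.comp_continuousOn (continuousOn_diskPath hz))

/-! ### Integral representation of the operator -/

lemma tendsto_partialSum {f : ℂ → ℂ} (hf : DifferentiableOn ℂ f disc) {w : ℂ} (hw : w ∈ disc) :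
    Tendsto (fun l => partialSum (taylorCoeff f) l w) atTop (𝓝 (f w)) := by
  have h := (Complex.hasSum_taylorSeries_on_ball hf hw).tendsto_sum_nat
  refine (h.comp (tendsto_add_atTop_nat 1)).congr fun l => ?_
  refine Finset.sum_congr rfl fun k _ => ?_
  simp only [taylorCoeff, smul_eq_mul, sub_zero]
  ring

section Representation

variable {f : ℂ → ℂ} {D β : ℝ} {N : ℕ}

/-- A weighted path integral of a power of `f` is the limit of those of the partial sums. -/
lemma tendsto_integral_partialSum_pow (hf : DifferentiableOn ℂ f disc) (hD : 0 ≤ D) (hβ : 0 ≤ β)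
    (hβ1 : β ≤ 1) (hβN : β * N < 1)
    (ha : ∀ n : ℕ, ‖partialSum (taylorCoeff f) n 1‖ ≤ D * ((n : ℝ) + 1) ^ β) {z : ℂ}
    (hz : ‖z‖ < 1) {c : ℝ → ℂ} (hc : ContinuousOn c (Set.Icc 0 1)) :
    Tendsto (fun l => ∫ t in (0 : ℝ)..1, c t * partialSum (taylorCoeff f) l (diskPath t z) ^ N)
      atTop (𝓝 (∫ t in (0 : ℝ)..1, c t * f (diskPath t z) ^ N)) := by
  obtain ⟨E, hE, hEl⟩ := exists_norm_partialSum_diskPath_le hD hβ hβ1 ha hz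
  obtain ⟨B, hB⟩ := isCompact_Icc.exists_bound_of_continuousOn hc
  apply intervalIntegral.tendsto_integral_filter_of_dominated_convergence
    (fun t => B * (E ^ N * (1 - t) ^ (-(β * N))))
  · refine Eventually.of_forall fun l => ?_
    rw [Set.uIoc_of_le zero_le_one]
    apply (ContinuousOn.mono _ Set.Ioc_subset_Icc_self).aestronglyMeasurable measurableSet_Ioc
    exact hc.mul (((continuous_partialSum _ l).comp_continuousOn (continuousOn_diskPath hz)).pow N)
  · refine Eventually.of_forall fun l => ae_uIoc_zero_one fun t ht0 ht1 => ?_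
    rw [norm_mul, norm_pow]
    have h1 := hB t ⟨ht0, ht1.le⟩
    have h2 := hEl l t ht0 ht1
    have hu : 0 ≤ 1 - t := by linarith
    have hB0 : 0 ≤ B := (norm_nonneg _).trans h1
    calc _ ≤ B * (E * (1 - t) ^ (-β)) ^ N := by gcongr
      _ = _ := by
        rw [mul_pow, ← Real.rpow_natCast ((1 - t) ^ (-β)), ← Real.rpow_mul hu, neg_mul]
  · exact ((intervalIntegrable_one_sub_rpow (by linarith)).const_mul _).const_mul _
  · exact ae_uIoc_zero_one fun t ht0 ht1 =>
      ((tendsto_partialSum hf (diskPath_mem_disc ht0 ht1 hz)).pow N).const_mul _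

lemma tendsto_hilbertPartialSum {m : ℕ} (hf : DifferentiableOn ℂ f disc) (hD : 0 ≤ D)
    (hβ : 0 ≤ β) (hβ1 : β ≤ 1) (hβN : β * (m - 1 : ℕ) < 1)
    (ha : ∀ n : ℕ, ‖partialSum (taylorCoeff f) n 1‖ ≤ D * ((n : ℝ) + 1) ^ β) (k : ℕ) :
    Tendsto (fun l => hilbertPartialSum m (taylorCoeff f) k l) atTop
      (𝓝 (∫ t in (0 : ℝ)..1, (t : ℂ) ^ k * f t ^ (m - 1))) := by
  -- At `z = 0` the path is the straight segment.
  have h := tendsto_integral_partialSum_pow hf hD hβ hβ1 hβN ha (z := 0) (by simp)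
    (c := fun t => (t : ℂ) ^ k) (by fun_prop)
  simp only [diskPath_zero_right] at h
  simpa only [hilbertPartialSum_eq_integral] using h

/-- The power series `ℋ(f)` converges to the Euler-type integral of `f ^ (m - 1)`. -/
lemma hasSum_hilbertCoeff {m : ℕ} (hf : DifferentiableOn ℂ f disc) (hD : 0 ≤ D)
    (hβ : 0 ≤ β) (hβ1 : β ≤ 1) (hβN : β * (m - 1 : ℕ) < 1)
    (ha : ∀ n : ℕ, ‖partialSum (taylorCoeff f) n 1‖ ≤ D * ((n : ℝ) + 1) ^ β) {z : ℂ}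
    (hz : ‖z‖ < 1) :
    HasSum (fun k => hilbertCoeff m (taylorCoeff f) k * z ^ k)
      (∫ t in (0 : ℝ)..1, (1 - (1 - t : ℂ) * z)⁻¹ * f (diskPath t z) ^ (m - 1)) := by
  have hcoef (k : ℕ) : hilbertCoeff m (taylorCoeff f) k * z ^ k =
      ∫ t in (0 : ℝ)..1, (t * z) ^ k * f t ^ (m - 1) := by
    rw [hilbertCoeff, (tendsto_hilbertPartialSum hf hD hβ hβ1 hβN ha k).limUnder_eq,
      ← intervalIntegral.integral_mul_const]
    refine intervalIntegral.integral_congr fun t _ => ?_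
    simp only [mul_pow]; ring
  obtain ⟨E, hE, hEl⟩ := exists_norm_partialSum_diskPath_le hD hβ hβ1 ha (z := 0) (by simp)
  simp only [diskPath_zero_right] at hEl
  have hfE (t : ℝ) (ht0 : 0 ≤ t) (ht1 : t < 1) :
      ‖f t ^ (m - 1)‖ ≤ E ^ (m - 1) * (1 - t) ^ (-(β * (m - 1 : ℕ))) := by
    have hu : 0 ≤ 1 - t := by linarith
    have hmem : (t : ℂ) ∈ disc := by
      rw [mem_disc, Complex.norm_real, Real.norm_of_nonneg ht0]; exact ht1
    have h1 : ‖f t‖ ≤ E * (1 - t) ^ (-β) :=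
      le_of_tendsto (tendsto_partialSum hf hmem).norm
        (Eventually.of_forall fun l => hEl l t ht0 ht1)
    rw [norm_pow]
    calc _ ≤ (E * (1 - t) ^ (-β)) ^ (m - 1) := by gcongr
      _ = _ := by
        rw [mul_pow, ← Real.rpow_natCast ((1 - t) ^ (-β)), ← Real.rpow_mul hu, neg_mul]
  have hmeas : AEStronglyMeasurable (fun t : ℝ => f t) (volume.restrict (Set.uIoc 0 1)) := by
    apply aestronglyMeasurable_of_tendsto_ae atTop
      (f := fun l (t : ℝ) => partialSum (taylorCoeff f) l t)
    · intro l
      exact ((continuous_partialSum _ l).comp Complex.continuous_ofReal).aestronglyMeasurable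
    · rw [ae_restrict_iff' measurableSet_uIoc]
      refine ae_uIoc_zero_one fun t ht0 ht1 => tendsto_partialSum hf ?_
      rw [mem_disc, Complex.norm_real, Real.norm_of_nonneg ht0]; exact ht1
  -- On the segment the geometric series in `t * z` may be integrated term by term.
  have hgeo : HasSum (fun k => hilbertCoeff m (taylorCoeff f) k * z ^ k)
      (∫ t in (0 : ℝ)..1, (1 - t * z)⁻¹ * f t ^ (m - 1)) := by
    simp_rw [hcoef]
    apply intervalIntegral.hasSum_integral_of_dominated_convergence
      (fun k t => ‖z‖ ^ k * (E ^ (m - 1) * (1 - t) ^ (-(β * (m - 1 : ℕ)))))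
    · intro k
      exact (Continuous.aestronglyMeasurable (by fun_prop)).mul (hmeas.pow _)
    · refine fun k => ae_uIoc_zero_one fun t ht0 ht1 => ?_
      rw [norm_mul]
      gcongr
      · rw [norm_pow, norm_mul, Complex.norm_real, Real.norm_of_nonneg ht0]
        gcongr
        exact mul_le_of_le_one_left (norm_nonneg _) ht1.le
      · exact hfE t ht0 ht1
    · exact Eventually.of_forall fun t _ =>
        (summable_geometric_of_lt_one (norm_nonneg _) hz).mul_right _
    · simp_rw [tsum_mul_right]
      exact ((intervalIntegrable_one_sub_rpow (by linarith)).const_mul _).const_mul _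
    · refine ae_uIoc_zero_one fun t ht0 ht1 => HasSum.mul_right _ ?_
      apply hasSum_geometric_of_norm_lt_one
      rw [norm_mul, Complex.norm_real, Real.norm_of_nonneg ht0]
      nlinarith [norm_nonneg z]
  convert hgeo using 1
  have hc : ContinuousOn (fun t : ℝ => (1 - t * z)⁻¹) (Set.Icc 0 1) := by
    refine ContinuousOn.inv₀ (by fun_prop) fun t ht => ?_
    rw [sub_ne_zero]
    intro h
    have := congrArg norm h
    rw [norm_one, norm_mul, Complex.norm_real, Real.norm_of_nonneg ht.1] at this
    nlinarith [norm_nonneg z, ht.2]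
  have l1 := tendsto_integral_partialSum_pow hf hD hβ hβ1 hβN ha (z := 0) (by simp) hc
  simp only [diskPath_zero_right] at l1
  -- Path independence needs a function analytic up to the endpoint `1`. It is used for the
  -- polynomial partial sums, and both sides then pass to the limit.
  refine tendsto_nhds_unique (tendsto_integral_partialSum_pow hf hD hβ hβ1 hβN ha hz
    (continuousOn_inv_one_sub_mul hz)) (l1.congr fun l => ?_)
  rw [← integral_div_one_sub_mul_eq_diskPath
    (P := fun w => partialSum (taylorCoeff f) l w ^ (m - 1))
    ((differentiable_partialSum _ l).pow _) hz]
  refine intervalIntegral.integral_congr fun t _ => ?_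
  simp only [div_eq_mul_inv, mul_comm]

end Representation

/-! ### Minkowski's inequality and change of variables -/

/-- Minkowski's integral inequality, with a majorant `c` of the norms of the sections. -/
lemma lintegral_lintegral_rpow_le {α β : Type*} [MeasurableSpace α] [MeasurableSpace β]
    (μ : Measure α) (ν : Measure β) [SFinite μ] [SFinite ν] {F : α → β → ENNReal}
    (hF : Measurable (Function.uncurry F)) {c : α → ENNReal} (hc : Measurable c)
    (hc0 : ∀ᵐ a ∂μ, c a ≠ 0 ∧ c a ≠ ⊤) {p : ℝ} (hp : 1 < p) (G : ENNReal)
    (h : ∀ᵐ a ∂μ, ∫⁻ b, F a b ^ p ∂ν ≤ c a ^ p * G) :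
    ∫⁻ b, (∫⁻ a, F a b ∂μ) ^ p ∂ν ≤ (∫⁻ a, c a ∂μ) ^ p * G := by
  have hp0 : 0 < p := by linarith
  set q := p.conjExponent with hq
  have hpq : p.HolderConjugate q := Real.HolderConjugate.conjExponent hp
  have hq0 : 0 < q := hpq.symm.pos
  set K := ∫⁻ a, c a ∂μ with hK
  have hpq' : 1 / q * p = p - 1 := by
    have := hpq.inv_add_inv_eq_one
    have h2 : q⁻¹ = 1 - p⁻¹ := by linarith
    rw [one_div, h2]; field_simp
  -- Hölder applied to `F = c^(1/q) · (c^(-1/q) F)`; after Tonelli the weight `c^(1-p)` meets the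
  -- hypothesis `c^p * G` and leaves `c * G`.
  have h1 (b : β) : (∫⁻ a, F a b ∂μ) ^ p ≤
      K ^ (p - 1) * ∫⁻ a, c a ^ (1 - p) * F a b ^ p ∂μ := by
    have hFb : Measurable fun a => F a b := hF.of_uncurry_right
    have e1 : ∫⁻ a, F a b ∂μ =
        ∫⁻ a, ((fun a => c a ^ (1 / q)) * fun a => c a ^ (-(1 / q)) * F a b) a ∂μ := by
      refine lintegral_congr_ae ?_
      filter_upwards [hc0] with a ha
      simp only [Pi.mul_apply]
      rw [← mul_assoc, ← ENNReal.rpow_add _ _ ha.1 ha.2, add_neg_cancel, ENNReal.rpow_zero, one_mul]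
    have e2 := ENNReal.lintegral_mul_le_Lp_mul_Lq μ hpq.symm (f := fun a => c a ^ (1 / q))
      (g := fun a => c a ^ (-(1 / q)) * F a b) (hc.pow_const _).aemeasurable
      ((hc.pow_const _).mul hFb).aemeasurable
    rw [← e1] at e2
    have e3 (a : α) : (c a ^ (1 / q)) ^ q = c a := by
      rw [← ENNReal.rpow_mul, one_div_mul_cancel hq0.ne', ENNReal.rpow_one]
    have e4 (a : α) : (c a ^ (-(1 / q)) * F a b) ^ p = c a ^ (1 - p) * F a b ^ p := by
      rw [ENNReal.mul_rpow_of_nonneg _ _ hp0.le, ← ENNReal.rpow_mul, neg_mul, hpq', neg_sub]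
    simp only [e3, e4] at e2
    calc _ ≤ (K ^ (1 / q) * (∫⁻ a, c a ^ (1 - p) * F a b ^ p ∂μ) ^ (1 / p)) ^ p :=
          ENNReal.rpow_le_rpow e2 hp0.le
      _ = _ := by
          rw [ENNReal.mul_rpow_of_nonneg _ _ hp0.le, ← ENNReal.rpow_mul, ← ENNReal.rpow_mul, hpq',
            one_div_mul_cancel hp0.ne', ENNReal.rpow_one]
  have hm : Measurable (Function.uncurry fun b a => c a ^ (1 - p) * F a b ^ p) :=
    ((hc.comp measurable_snd).pow_const _).mul ((hF.comp measurable_swap).pow_const _)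
  calc _ ≤ ∫⁻ b, K ^ (p - 1) * ∫⁻ a, c a ^ (1 - p) * F a b ^ p ∂μ ∂ν := lintegral_mono h1
    _ = K ^ (p - 1) * ∫⁻ a, ∫⁻ b, c a ^ (1 - p) * F a b ^ p ∂ν ∂μ := by
        rw [lintegral_const_mul _ hm.lintegral_prod_right, lintegral_lintegral_swap hm.aemeasurable]
    _ ≤ K ^ (p - 1) * ∫⁻ a, c a * G ∂μ := by
        gcongr 1
        refine lintegral_mono_ae ?_
        filter_upwards [hc0, h] with a ha ha'
        rw [lintegral_const_mul _ ((hF.of_uncurry_left).pow_const _)]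
        calc _ ≤ c a ^ (1 - p) * (c a ^ p * G) := by gcongr
          _ = _ := by
            rw [← mul_assoc, ← ENNReal.rpow_add _ _ ha.1 ha.2, sub_add_cancel, ENNReal.rpow_one]
    _ = K ^ p * G := by
        rw [lintegral_mul_const _ hc, ← mul_assoc]
        congr 1
        rw [← hK]
        nth_rw 2 [← ENNReal.rpow_one K]
        rw [← ENNReal.rpow_add_of_nonneg _ _ (by linarith) zero_le_one, sub_add_cancel]

lemma hasDerivAt_diskPath {t : ℝ} (ht0 : 0 ≤ t) (ht : t ≤ 1) {z : ℂ} (hz : ‖z‖ < 1) :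
    HasDerivAt (diskPath t) (t * (1 - t) * ((1 - (1 - t : ℂ) * z)⁻¹) ^ 2) z := by
  have hden := one_sub_mul_ne_zero ht0 ht hz
  have hD : HasDerivAt (fun z : ℂ => 1 - (1 - t : ℂ) * z) (-(1 - t : ℂ)) z := by
    have := ((hasDerivAt_id z).const_mul (1 - t : ℂ)).const_sub 1
    simpa using this
  refine ((hasDerivAt_const z (t : ℂ)).div hD hden).congr_deriv ?_
  field_simp
  ring

lemma injOn_diskPath {t : ℝ} (ht0 : 0 < t) (ht : t < 1) : Set.InjOn (diskPath t) disc := by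
  intro z hz w hw h
  rw [mem_disc] at hz hw
  have hz' := one_sub_mul_ne_zero ht0.le ht.le hz
  have hw' := one_sub_mul_ne_zero ht0.le ht.le hw
  have ht' : (t : ℂ) ≠ 0 := by exact_mod_cast ht0.ne'
  have ht1 : (1 - t : ℂ) ≠ 0 := by
    rw [sub_ne_zero]; exact_mod_cast ht.ne'
  rw [diskPath, diskPath, div_eq_div_iff hz' hw'] at h
  have h2 := mul_left_cancel₀ ht' h
  have h3 : (1 - t : ℂ) * w = (1 - t) * z := by linear_combination -h2
  exact (mul_left_cancel₀ ht1 h3).symm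

/-- Change of variables for the weighted composition operators `f ↦ ω_t · f ∘ φ_t`. -/
lemma lintegral_diskPath_le {p : ℝ} (hp : 0 ≤ p) {t C : ℝ} (ht0 : 0 < t) (ht : t < 1)
    (hC0 : 0 ≤ C)
    (hC : ∀ z ∈ disc, ‖(1 - (1 - t : ℂ) * z)⁻¹‖ ^ (p - 4) ≤ C ^ p * (t * (1 - t)) ^ 2)
    (g : ℂ → ℂ) :
    ∫⁻ z in disc, ‖(1 - (1 - t : ℂ) * z)⁻¹ * g (diskPath t z)‖ₑ ^ p ≤
      ENNReal.ofReal C ^ p * ∫⁻ z in disc, ‖g z‖ₑ ^ p := by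
  set ω : ℂ → ℂ := fun z => (1 - (1 - t : ℂ) * z)⁻¹ with hω
  have hcov := lintegral_image_eq_lintegral_abs_det_fderiv_mul volume isOpen_disc.measurableSet
    (fun z hz => ((hasDerivAt_diskPath ht0.le ht.le
      (mem_disc.1 hz)).hasFDerivAt.restrictScalars ℝ).hasFDerivWithinAt)
    (injOn_diskPath ht0 ht) (fun w => ‖g w‖ₑ ^ p)
  have himg : diskPath t '' disc ⊆ disc := by
    rintro _ ⟨z, hz, rfl⟩
    exact diskPath_mem_disc ht0.le ht (mem_disc.1 hz)
  calc _ ≤ ∫⁻ z in disc, ENNReal.ofReal C ^ p *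
        (ENNReal.ofReal ((t * (1 - t) * ‖ω z‖ ^ 2) ^ 2) * ‖g (diskPath t z)‖ₑ ^ p) := by
        refine setLIntegral_mono' isOpen_disc.measurableSet fun z hz => ?_
        rw [enorm_mul, ENNReal.mul_rpow_of_nonneg _ _ hp, ← mul_assoc]
        gcongr
        rw [← ofReal_norm_rpow _ hp, ENNReal.ofReal_rpow_of_nonneg hC0 hp,
          ← ENNReal.ofReal_mul (by positivity)]
        apply ENNReal.ofReal_le_ofReal
        have hpos : 0 < ‖ω z‖ :=
          norm_pos_iff.2 (inv_ne_zero (one_sub_mul_ne_zero ht0.le ht.le (mem_disc.1 hz)))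
        -- The fourth power belongs to the Jacobian; only the power `p - 4` has to be estimated.
        have h1 : ‖ω z‖ ^ p = ‖ω z‖ ^ (p - 4) * ‖ω z‖ ^ 4 := by
          rw [← Real.rpow_natCast, ← Real.rpow_add hpos]; congr 1; push_cast; ring
        change ‖ω z‖ ^ p ≤ _
        rw [h1]
        calc _ ≤ (C ^ p * (t * (1 - t)) ^ 2) * ‖ω z‖ ^ 4 := by gcongr; exact hC z hz
          _ = _ := by ring
    _ = ENNReal.ofReal C ^ p * ∫⁻ z in diskPath t '' disc, ‖g z‖ₑ ^ p := by
        rw [lintegral_const_mul' _ _ (ENNReal.rpow_ne_top_of_nonneg hp ENNReal.ofReal_ne_top), hcov]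
        congr 1
        refine setLIntegral_congr_fun isOpen_disc.measurableSet fun z _ => ?_
        have hu : (0 : ℝ) ≤ 1 - t := by linarith
        have hn : ‖(1 - t : ℂ)‖ = 1 - t := by
          rw [← Complex.ofReal_one, ← Complex.ofReal_sub, Complex.norm_real, Real.norm_of_nonneg hu]
        congr 2
        -- The real determinant of multiplication by a complex number is its squared modulus.
        simp only [ContinuousLinearMap.det, ContinuousLinearMap.coe_restrictScalars,
          LinearMap.det_restrictScalars, Algebra.norm_complex_eq]
        simp [hω, hn, mul_pow, Complex.normSq_eq_norm_sq]
    _ ≤ _ := by gcongr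

/-! ### Beta integrals and the two majorants -/

/-- Euler's beta integral over the reals. -/
lemma intervalIntegrable_and_integral_beta {u v : ℝ} (hu : 0 < u) (hv : 0 < v) :
    IntervalIntegrable (fun t : ℝ => t ^ (u - 1) * (1 - t) ^ (v - 1)) volume 0 1 ∧
    ∫ t in (0 : ℝ)..1, t ^ (u - 1) * (1 - t) ^ (v - 1) =
      Real.Gamma u * Real.Gamma v / Real.Gamma (u + v) := by
  have hcast : ∀ t ∈ Set.Ioc (0 : ℝ) 1, (t : ℂ) ^ ((u : ℂ) - 1) * (1 - t : ℂ) ^ ((v : ℂ) - 1) =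
      ((t ^ (u - 1) * (1 - t) ^ (v - 1) : ℝ) : ℂ) := by
    intro t ht
    rw [Complex.ofReal_mul, Complex.ofReal_cpow ht.1.le, Complex.ofReal_cpow (by linarith [ht.2])]
    push_cast; rfl
  constructor
  · have h := Complex.betaIntegral_convergent (u := u) (v := v) (by simpa) (by simpa)
    rw [intervalIntegrable_iff_integrableOn_Ioc_of_le zero_le_one] at h ⊢
    have h2 : Integrable (fun t : ℝ => t ^ (u - 1) * (1 - t) ^ (v - 1))
        (volume.restrict (Set.Ioc 0 1)) := by
      simpa using Integrable.re (h.congr_fun hcast measurableSet_Ioc)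
    exact h2
  · have h := ProbabilityTheory.beta_eq_betaIntegralReal u v hu hv
    rw [ProbabilityTheory.beta, Complex.betaIntegral] at h
    rw [h, intervalIntegral.integral_of_le zero_le_one, intervalIntegral.integral_of_le zero_le_one,
      setIntegral_congr_fun measurableSet_Ioc hcast, integral_complex_ofReal,
      Complex.ofReal_re]

lemma lintegral_ofReal_Ioo {C : ℝ → ℝ} (hi : IntervalIntegrable C volume 0 1)
    (h0 : ∀ t ∈ Set.Ioo (0 : ℝ) 1, 0 ≤ C t) :
    ∫⁻ t in Set.Ioo (0 : ℝ) 1, ENNReal.ofReal (C t) =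
      ENNReal.ofReal (∫ t in (0 : ℝ)..1, C t) := by
  rw [intervalIntegral.integral_of_le zero_le_one, integral_Ioc_eq_integral_Ioo,
    ofReal_integral_eq_lintegral_ofReal]
  · rw [intervalIntegrable_iff_integrableOn_Ioo_of_le zero_le_one] at hi
    exact hi
  · exact (ae_restrict_iff' measurableSet_Ioo).2 (Eventually.of_forall h0)

/-- `C` majorizes the norms of the weighted composition operators `f ↦ ω_t · f ∘ φ_t` on `A^p`, and
has integral `K`. -/
structure IsPathMajorant (p : ℝ) (C : ℝ → ℝ) (K : ℝ) : Prop where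
  measurable : Measurable C
  pos : ∀ t ∈ Set.Ioo (0 : ℝ) 1, 0 < C t
  le : ∀ t ∈ Set.Ioo (0 : ℝ) 1, ∀ z ∈ disc,
    ‖(1 - (1 - t : ℂ) * z)⁻¹‖ ^ (p - 4) ≤ C t ^ p * (t * (1 - t)) ^ 2
  lintegral_eq : ∫⁻ t in Set.Ioo (0 : ℝ) 1, ENNReal.ofReal (C t) = ENNReal.ofReal K
  const_pos : 0 < K

/-- Here `p - 4 ≥ 0`, so `|ω_t| ≤ 1/t` applies, and `C` is the function for which `C^p (t (1 - t))^2
= t^(4-p)`. Its integral is `B(2/p, 1 - 2/p)`, evaluated by the reflection formula. -/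
lemma isPathMajorant_of_four_le {p : ℝ} (hp : 4 ≤ p) :
    IsPathMajorant p (fun t => t ^ (2 / p - 1) * (1 - t) ^ ((1 - 2 / p) - 1))
      (Real.pi / Real.sin (2 * Real.pi / p)) := by
  have hp0 : 0 < p := by linarith
  have h2p : 0 < 2 / p := by positivity
  have h2p' : 0 < 1 - 2 / p := by rw [sub_pos, div_lt_one hp0]; linarith
  have hK : Real.pi / Real.sin (2 * Real.pi / p) =
      Real.Gamma (2 / p) * Real.Gamma (1 - 2 / p) / Real.Gamma (2 / p + (1 - 2 / p)) := by
    rw [add_sub_cancel, Real.Gamma_one, div_one, Real.Gamma_mul_Gamma_one_sub]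
    congr 2; ring
  have hb := intervalIntegrable_and_integral_beta h2p h2p'
  refine ⟨by fun_prop, fun t ht => ?_, fun t ht z hz => ?_, ?_, ?_⟩
  · have : 0 < 1 - t := by linarith [ht.2]
    have := ht.1
    positivity
  · have hu : 0 < 1 - t := by linarith [ht.2]
    have ht0 := ht.1
    have h1 : (t ^ (2 / p - 1) * (1 - t) ^ ((1 - 2 / p) - 1)) ^ p * (t * (1 - t)) ^ 2 =
        t⁻¹ ^ (p - 4) := by
      rw [Real.mul_rpow (by positivity) (by positivity), ← Real.rpow_mul ht0.le,
        ← Real.rpow_mul hu.le, mul_pow, ← Real.rpow_natCast t, ← Real.rpow_natCast (1 - t),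
        mul_mul_mul_comm, ← Real.rpow_add ht0, ← Real.rpow_add hu, Real.inv_rpow ht0.le,
        ← Real.rpow_neg ht0.le]
      have e1 : (2 / p - 1) * p + (2 : ℕ) = -(p - 4) := by field_simp; push_cast; ring
      have e2 : ((1 - 2 / p) - 1) * p + (2 : ℕ) = 0 := by field_simp; push_cast; ring
      rw [e1, e2, Real.rpow_zero, mul_one]
    rw [h1, norm_inv]
    have h2 := le_norm_one_sub_mul ht.2.le (mem_disc.1 hz)
    apply Real.rpow_le_rpow (by positivity) _ (by linarith)
    gcongr
  · rw [lintegral_ofReal_Ioo hb.1, hb.2, hK]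
    intro t ht
    have : 0 < 1 - t := by linarith [ht.2]
    have := ht.1
    positivity
  · rw [hK, add_sub_cancel, Real.Gamma_one]
    have := Real.Gamma_pos_of_pos h2p
    have := Real.Gamma_pos_of_pos h2p'
    positivity

/-- Now `p - 4 ≤ 0`, so a lower bound of `|ω_t|` is needed: `|1 - (1 - t) z| ≤ 2`. The integral is a
multiple of `B(s, s)` with `s = 1 - 2/p`, positive because `p > 2`; Legendre's duplication formula
brings it to the stated form. -/
lemma isPathMajorant_of_le_four {p : ℝ} (hp : 2 < p) (hp4 : p ≤ 4) :
    IsPathMajorant p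
      (fun t => 2 ^ (4 / p - 1) * (t ^ ((1 - 2 / p) - 1) * (1 - t) ^ ((1 - 2 / p) - 1)))
      ((4 : ℝ) ^ (4 / p - 1) * Real.sqrt Real.pi *
          (Real.Gamma (1 - 2 / p) / Real.Gamma (3 / 2 - 2 / p))) := by
  have hp0 : 0 < p := by linarith
  have hs : 0 < 1 - 2 / p := by rw [sub_pos, div_lt_one hp0]; linarith
  have hg1 := Real.Gamma_pos_of_pos hs
  have hg2 : 0 < Real.Gamma (3 / 2 - 2 / p) := Real.Gamma_pos_of_pos (by linarith)
  have hg3 : 0 < Real.Gamma ((1 - 2 / p) + (1 - 2 / p)) := Real.Gamma_pos_of_pos (by linarith)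
  have hK : (4 : ℝ) ^ (4 / p - 1) * Real.sqrt Real.pi *
      (Real.Gamma (1 - 2 / p) / Real.Gamma (3 / 2 - 2 / p)) = 2 ^ (4 / p - 1) *
      (Real.Gamma (1 - 2 / p) * Real.Gamma (1 - 2 / p) /
        Real.Gamma ((1 - 2 / p) + (1 - 2 / p))) := by
    have hd := Real.Gamma_mul_Gamma_add_half (1 - 2 / p)
    rw [show 1 - 2 / p + 1 / 2 = 3 / 2 - 2 / p by ring, two_mul,
      show 1 - ((1 - 2 / p) + (1 - 2 / p)) = 4 / p - 1 by ring] at hd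
    rw [show (4 : ℝ) = 2 * 2 by norm_num, Real.mul_rpow (by norm_num) (by norm_num)]
    rw [show (2 : ℝ) * 2 = 4 by norm_num]
    generalize Real.Gamma (1 - 2 / p) = A at *
    generalize Real.Gamma (3 / 2 - 2 / p) = B at *
    generalize Real.Gamma ((1 - 2 / p) + (1 - 2 / p)) = D at *
    generalize (2 : ℝ) ^ (4 / p - 1) = x at *
    field_simp
    linear_combination -x * hd
  have hb := intervalIntegrable_and_integral_beta hs hs
  refine ⟨by fun_prop, fun t ht => ?_, fun t ht z hz => ?_, ?_, ?_⟩
  · have : 0 < 1 - t := by linarith [ht.2]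
    have := ht.1
    positivity
  · have hu : 0 < 1 - t := by linarith [ht.2]
    have ht0 := ht.1
    have h1 : (2 ^ (4 / p - 1) * (t ^ ((1 - 2 / p) - 1) * (1 - t) ^ ((1 - 2 / p) - 1))) ^ p *
        (t * (1 - t)) ^ 2 = (2 : ℝ) ^ (4 - p) := by
      rw [Real.mul_rpow (by positivity) (by positivity),
        Real.mul_rpow (by positivity) (by positivity), ← Real.rpow_mul ht0.le,
        ← Real.rpow_mul hu.le, ← Real.rpow_mul (by norm_num), mul_pow, ← Real.rpow_natCast t,
        ← Real.rpow_natCast (1 - t), mul_assoc,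
        mul_mul_mul_comm, ← Real.rpow_add ht0, ← Real.rpow_add hu]
      have e1 : (4 / p - 1) * p = 4 - p := by field_simp
      have e2 : ((1 - 2 / p) - 1) * p + (2 : ℕ) = 0 := by field_simp; push_cast; ring
      rw [e1, e2, Real.rpow_zero, Real.rpow_zero, mul_one, mul_one]
    rw [h1, norm_inv, ← Real.rpow_neg_one, ← Real.rpow_mul (norm_nonneg _),
      show -1 * (p - 4) = 4 - p by ring]
    have h2 := norm_one_sub_mul_le ht.2.le z
    have h3 := mem_disc.1 hz
    apply Real.rpow_le_rpow (norm_nonneg _) _ (by linarith)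
    nlinarith [norm_nonneg z]
  · rw [lintegral_ofReal_Ioo (hb.1.const_mul _), intervalIntegral.integral_const_mul, hb.2, hK]
    intro t ht
    have : 0 < 1 - t := by linarith [ht.2]
    have := ht.1
    positivity
  · rw [hK]
    positivity

/-! ### Norm estimates in Bergman spaces -/

/-- Boundedness on `A^p` of `g ↦ ∫ ω_t · g ∘ φ_t dt`. -/
lemma lintegral_enorm_integral_diskPath_le {p K : ℝ} {C : ℝ → ℝ} (hp : 1 < p)
    (hC : IsPathMajorant p C K) {g : ℂ → ℂ} (hg : ContinuousOn g disc) :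
    ∫⁻ z in disc, ‖∫ t in (0 : ℝ)..1, (1 - (1 - t : ℂ) * z)⁻¹ * g (diskPath t z)‖ₑ ^ p ≤
      ENNReal.ofReal K ^ p * ∫⁻ z in disc, ‖g z‖ₑ ^ p := by
  have hp0 : 0 ≤ p := by linarith
  -- Cutting `g` off outside the disc gives joint measurability, since `g` is controlled only there.
  set F : ℝ → ℂ → ENNReal := fun t z =>
    ‖(1 - (1 - t : ℂ) * z)⁻¹ * disc.indicator g (diskPath t z)‖ₑ with hF
  have hden : Measurable fun q : ℝ × ℂ => 1 - (1 - q.1 : ℂ) * q.2 := by fun_prop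
  have hpath : Measurable fun q : ℝ × ℂ => diskPath q.1 q.2 := by
    unfold diskPath
    exact Measurable.div (by fun_prop) hden
  have hFm : Measurable (Function.uncurry F) :=
    (hden.inv.mul ((measurable_indicator_disc hg).comp hpath)).enorm
  have hmink := lintegral_lintegral_rpow_le (volume.restrict (Set.Ioo (0 : ℝ) 1))
    (volume.restrict disc) hFm (ENNReal.measurable_ofReal.comp hC.measurable)
    (by
      rw [ae_restrict_iff' measurableSet_Ioo]
      refine Eventually.of_forall fun t ht => ⟨?_, ENNReal.ofReal_ne_top⟩
      simpa using hC.pos t ht) hp (∫⁻ z in disc, ‖g z‖ₑ ^ p)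
    (by
      rw [ae_restrict_iff' measurableSet_Ioo]
      refine Eventually.of_forall fun t ht => ?_
      refine (lintegral_diskPath_le hp0 ht.1 ht.2 (hC.pos t ht).le (hC.le t ht) _).trans
        (le_of_eq ?_)
      congr 1
      refine setLIntegral_congr_fun isOpen_disc.measurableSet fun z hz => ?_
      simp only [Set.indicator_of_mem hz])
  simp only [Function.comp_def] at hmink
  rw [hC.lintegral_eq] at hmink
  refine le_trans (setLIntegral_mono' isOpen_disc.measurableSet fun z hz => ?_) hmink
  apply ENNReal.rpow_le_rpow _ hp0
  rw [intervalIntegral.integral_of_le zero_le_one, integral_Ioc_eq_integral_Ioo]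
  refine (enorm_integral_le_lintegral_enorm _).trans (le_of_eq ?_)
  refine setLIntegral_congr_fun measurableSet_Ioo fun t ht => ?_
  simp only [hF, Set.indicator_of_mem (diskPath_mem_disc ht.1.le ht.2 (mem_disc.1 hz))]

lemma bergmanNorm_nonneg (p : ℝ) (f : ℂ → ℂ) : 0 ≤ bergmanNorm p f :=
  Real.rpow_nonneg (integral_nonneg fun _ => Real.rpow_nonneg (norm_nonneg _) _) _

lemma aestronglyMeasurable_norm_rpow {p : ℝ} (hp : 0 ≤ p) {f : ℂ → ℂ} (hf : ContinuousOn f disc) :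
    AEStronglyMeasurable (fun z => ‖f z‖ ^ p) (volume.restrict disc) :=
  (hf.norm.rpow_const fun _ _ => Or.inr hp).aestronglyMeasurable isOpen_disc.measurableSet

lemma bergmanNorm_eq {p : ℝ} (hp : 0 ≤ p) {f : ℂ → ℂ} (hf : ContinuousOn f disc) :
    bergmanNorm p f =
      (Real.pi⁻¹ * (∫⁻ z in disc, ‖f z‖ₑ ^ p).toReal) ^ (1 / p) := by
  have h := integral_eq_lintegral_of_nonneg_ae (μ := volume.restrict disc)
    (f := fun z => ‖f z‖ ^ p)
    (Eventually.of_forall fun z => Real.rpow_nonneg (norm_nonneg _) _)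
    (aestronglyMeasurable_norm_rpow hp hf)
  simp_rw [ofReal_norm_rpow _ hp] at h
  rw [bergmanNorm, discMeasure_eq, integral_smul_measure, h, smul_eq_mul, ENNReal.toReal_inv,
    ENNReal.toReal_ofReal Real.pi_pos.le]

lemma memBergman_of_lintegral_lt_top {p : ℝ} (hp : 0 ≤ p) {f : ℂ → ℂ}
    (hf : DifferentiableOn ℂ f disc) (h : ∫⁻ z in disc, ‖f z‖ₑ ^ p < ⊤) : MemBergman p f := by
  refine ⟨hf.analyticOnNhd isOpen_disc, ?_⟩
  rw [discMeasure_eq]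
  refine Integrable.smul_measure ⟨aestronglyMeasurable_norm_rpow hp hf.continuousOn, ?_⟩ (by simp [Real.pi_pos])
  rw [hasFiniteIntegral_iff_ofReal (Eventually.of_forall fun z =>
    Real.rpow_nonneg (norm_nonneg _) _)]
  simpa only [ofReal_norm_rpow _ hp] using h

/-- A power series converging on the disc has an analytic sum there. -/
lemma differentiableOn_disc_of_hasSum {a : ℕ → ℂ} {F : ℂ → ℂ}
    (h : ∀ z ∈ disc, HasSum (fun k => a k * z ^ k) (F z)) : DifferentiableOn ℂ F disc := by
  intro z hz
  obtain ⟨r, hr1, hr2⟩ := exists_between (mem_disc.1 hz)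
  have hr0 : 0 < r := (norm_nonneg _).trans_lt hr1
  -- The terms at `s` are bounded, so those at `r < s` are dominated by a geometric series.
  obtain ⟨s, hs1, hs2⟩ := exists_between hr2
  have hs0 : 0 < s := hr0.trans hs1
  have hsum : Summable fun k => ‖a k‖ * r ^ k := by
    have hs := h (s : ℂ) (by
      rw [mem_disc, Complex.norm_real, Real.norm_of_nonneg hs0.le]; exact hs2)
    have h2 := hs.summable.tendsto_atTop_zero.norm
    obtain ⟨B, hB⟩ := h2.bddAbove_range
    apply Summable.of_nonneg_of_le (fun k => by positivity) (fun k => ?_)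
      ((summable_geometric_of_lt_one (r := r / s) (by positivity)
        ((div_lt_one hs0).2 hs1)).mul_left B)
    have hk : ‖a k‖ * s ^ k ≤ B := by
      have := hB ⟨k, rfl⟩
      simpa [Real.norm_of_nonneg hs0.le, abs_of_pos hs0] using this
    calc ‖a k‖ * r ^ k = (‖a k‖ * s ^ k) * (r / s) ^ k := by
          rw [div_pow]; field_simp
      _ ≤ _ := by gcongr
  have hd : DifferentiableOn ℂ (fun w => ∑' k, a k * w ^ k) (Metric.ball 0 r) := by
    apply Complex.differentiableOn_tsum_of_summable_norm hsum (fun k => by fun_prop) Metric.isOpen_ball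
    intro k w hw
    rw [mem_ball_zero_iff] at hw
    rw [norm_mul, norm_pow]
    gcongr
  have hzr : z ∈ Metric.ball (0 : ℂ) r := by simpa using hr1
  have hd2 : DifferentiableOn ℂ F (Metric.ball 0 r) := hd.congr fun w hw => by
    rw [mem_ball_zero_iff] at hw
    exact (h w (mem_disc.2 (hw.trans hr2))).tsum_eq.symm
  exact (hd2.differentiableAt (Metric.isOpen_ball.mem_nhds hzr)).differentiableWithinAt

/-! ### The Hilbert tensor operator on Bergman functions -/

/-- The Taylor coefficients of Bergman functions have partial sums of small power growth. -/
lemma MemBergman.exists_norm_partialSum_le {p : ℝ} (hp : 2 < p) {N : ℕ} (hN : 1 ≤ N) {f : ℂ → ℂ}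
    (hf : MemBergman (p * N) f) :
    ∃ D β : ℝ, 0 ≤ D ∧ 0 ≤ β ∧ β ≤ 1 ∧ β * N < 1 ∧
      ∀ n : ℕ, ‖partialSum (taylorCoeff f) n 1‖ ≤ D * ((n : ℝ) + 1) ^ β := by
  have hN1 : (1 : ℝ) ≤ N := by exact_mod_cast hN
  have hN0 : (0 : ℝ) < N := by linarith
  have hq : 1 < p * N := by nlinarith
  have hq0 : 0 < p * N := by linarith
  obtain ⟨C, hC, hfC⟩ := hf.exists_norm_le hq
  -- The condition `p > 2` leaves room for `β` above the growth exponent of `f` and below `1 / N`.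
  have hlt : 2 / (p * N) < 1 / N := by
    rw [div_lt_div_iff₀ hq0 hN0]; nlinarith
  obtain ⟨β, hβ1, hβ2⟩ := exists_between hlt
  have hb0 : 0 < 2 / (p * N) := by positivity
  have hN2 : 1 / (N : ℝ) ≤ 1 := (div_le_one hN0).2 hN1
  obtain ⟨D, hD, hDn⟩ := exists_norm_sum_taylorCoeff_le hf.1.differentiableOn hb0.le hC hfC
    (δ := β - 2 / (p * N)) (by linarith) (by linarith)
  refine ⟨D, β, hD, by linarith, by linarith, (lt_div_iff₀ hN0).1 hβ2, fun n => ?_⟩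
  simpa [partialSum] using hDn n

section HilbertOperator

variable {m : ℕ} {p : ℝ} {f : ℂ → ℂ}

lemma MemBergman.tendsto_hilbertPartialSum (hm : 2 ≤ m) (hp : 2 < p)
    (hf : MemBergman (p * ((m : ℝ) - 1)) f) (k : ℕ) :
    Tendsto (fun l => hilbertPartialSum m (taylorCoeff f) k l) atTop
      (𝓝 (hilbertCoeff m (taylorCoeff f) k)) := by
  rw [← Nat.cast_pred (by omega)] at hf
  obtain ⟨D, β, hD, hβ, hβ1, hβN, ha⟩ := hf.exists_norm_partialSum_le hp (by omega)
  have h := _root_.tendsto_hilbertPartialSum hf.1.differentiableOn hD hβ hβ1 hβN ha k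
  rwa [hilbertCoeff, h.limUnder_eq]

lemma MemBergman.hasSum_hilbertCoeff (hm : 2 ≤ m) (hp : 2 < p)
    (hf : MemBergman (p * ((m : ℝ) - 1)) f) {z : ℂ} (hz : z ∈ disc) :
    HasSum (fun k => hilbertCoeff m (taylorCoeff f) k * z ^ k)
      (∫ t in (0 : ℝ)..1, (1 - (1 - t : ℂ) * z)⁻¹ * f (diskPath t z) ^ (m - 1)) := by
  rw [← Nat.cast_pred (by omega)] at hf
  obtain ⟨D, β, hD, hβ, hβ1, hβN, ha⟩ := hf.exists_norm_partialSum_le hp (by omega)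
  exact _root_.hasSum_hilbertCoeff hf.1.differentiableOn hD hβ hβ1 hβN ha (mem_disc.1 hz)

lemma MemBergman.differentiableOn_hilbertOp (hm : 2 ≤ m) (hp : 2 < p)
    (hf : MemBergman (p * ((m : ℝ) - 1)) f) : DifferentiableOn ℂ (hilbertOp m f) disc :=
  differentiableOn_disc_of_hasSum fun _ hz =>
    (hf.hasSum_hilbertCoeff hm hp hz).summable.hasSum

/-- The path operator is applied to `f^(m-1)`, whose `p`-th power modulus is `|f|^(p(m-1))`; this
fixes the exponent of the source space. -/
lemma MemBergman.lintegral_hilbertOp_le (hm : 2 ≤ m) (hp : 2 < p)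
    (hf : MemBergman (p * ((m : ℝ) - 1)) f) {C : ℝ → ℝ} {K : ℝ} (hC : IsPathMajorant p C K) :
    ∫⁻ z in disc, ‖hilbertOp m f z‖ₑ ^ p ≤
      ENNReal.ofReal K ^ p * ∫⁻ z in disc, ‖f z‖ₑ ^ (p * ((m : ℝ) - 1)) := by
  have h := lintegral_enorm_integral_diskPath_le (by linarith) hC
    (g := fun z => f z ^ (m - 1)) (hf.1.differentiableOn.continuousOn.pow _)
  have e1 : ∫⁻ z in disc, ‖hilbertOp m f z‖ₑ ^ p = ∫⁻ z in disc,
      ‖∫ t in (0 : ℝ)..1, (1 - (1 - t : ℂ) * z)⁻¹ * f (diskPath t z) ^ (m - 1)‖ₑ ^ p := by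
    refine setLIntegral_congr_fun isOpen_disc.measurableSet fun z hz => ?_
    simp only [hilbertOp, (hf.hasSum_hilbertCoeff hm hp hz).tsum_eq]
  rw [e1]
  refine h.trans (le_of_eq ?_)
  congr 1
  refine lintegral_congr fun z => ?_
  rw [enorm_pow, ← ENNReal.rpow_natCast, ← ENNReal.rpow_mul, Nat.cast_pred (by omega), mul_comm]

lemma MemBergman.memBergman_hilbertOp (hm : 2 ≤ m) (hp : 2 < p)
    (hf : MemBergman (p * ((m : ℝ) - 1)) f) {C : ℝ → ℝ} {K : ℝ} (hC : IsPathMajorant p C K) :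
    MemBergman p (hilbertOp m f) := by
  have hm1 : (0 : ℝ) ≤ (m : ℝ) - 1 := by
    have : (2 : ℝ) ≤ m := by exact_mod_cast hm
    linarith
  refine memBergman_of_lintegral_lt_top (by linarith) (hf.differentiableOn_hilbertOp hm hp)
    ((hf.lintegral_hilbertOp_le hm hp hC).trans_lt (ENNReal.mul_lt_top ?_
      (hf.lintegral_lt_top (mul_nonneg (by linarith) hm1))))
  exact (ENNReal.rpow_ne_top_of_nonneg (by linarith) ENNReal.ofReal_ne_top).lt_top

lemma MemBergman.bergmanNorm_hilbertOp_le (hm : 2 ≤ m) (hp : 2 < p)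
    (hf : MemBergman (p * ((m : ℝ) - 1)) f) {C : ℝ → ℝ} {K : ℝ} (hC : IsPathMajorant p C K) :
    bergmanNorm p (hilbertOp m f) ≤ K * bergmanNorm (p * ((m : ℝ) - 1)) f ^ (m - 1) := by
  have hp0 : 0 < p := by linarith
  have hm1 : (0 : ℝ) < (m : ℝ) - 1 := by
    have : (2 : ℝ) ≤ m := by exact_mod_cast hm
    linarith
  have hq : 0 < p * ((m : ℝ) - 1) := by positivity
  have hK := hC.const_pos.le
  rw [bergmanNorm_eq hp0.le (hf.differentiableOn_hilbertOp hm hp).continuousOn,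
    bergmanNorm_eq hq.le hf.1.differentiableOn.continuousOn]
  have h := hf.lintegral_hilbertOp_le hm hp hC
  have hX := hf.lintegral_lt_top hq.le
  set X := ∫⁻ z in disc, ‖f z‖ₑ ^ (p * ((m : ℝ) - 1))
  have h2 := ENNReal.toReal_mono (ENNReal.mul_ne_top
    (ENNReal.rpow_ne_top_of_nonneg hp0.le ENNReal.ofReal_ne_top) hX.ne) h
  rw [ENNReal.toReal_mul, ← ENNReal.toReal_rpow, ENNReal.toReal_ofReal hK] at h2
  have hπ := Real.pi_pos
  calc _ ≤ (Real.pi⁻¹ * (K ^ p * X.toReal)) ^ (1 / p) := by gcongr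
    _ = (K ^ p) ^ (1 / p) * (Real.pi⁻¹ * X.toReal) ^ (1 / p) := by
        rw [← Real.mul_rpow (by positivity) (by positivity)]; congr 1; ring
    _ = _ := by
        rw [← Real.rpow_mul hK, mul_one_div_cancel hp0.ne', Real.rpow_one, ← Real.rpow_natCast,
          ← Real.rpow_mul (by positivity), Nat.cast_pred (by omega)]
        congr 2
        field_simp

end HilbertOperator

/-! ### Homogeneity and the normalized operator -/

lemma taylorCoeff_const_mul (c : ℂ) (f : ℂ → ℂ) (k : ℕ) :
    taylorCoeff (fun w => c * f w) k = c * taylorCoeff f k := by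
  simp only [taylorCoeff, iteratedDeriv_const_mul_field, mul_div_assoc]

lemma hilbertPartialSum_const_mul (m : ℕ) (c : ℂ) (a : ℕ → ℂ) (k l : ℕ) :
    hilbertPartialSum m (fun n => c * a n) k l = c ^ (m - 1) * hilbertPartialSum m a k l := by
  simp only [hilbertPartialSum, Finset.prod_mul_distrib, Finset.prod_const, Finset.card_univ,
    Fintype.card_fin, Finset.mul_sum]
  exact Finset.sum_congr rfl fun i _ => by ring

lemma bergmanNorm_const_mul {p : ℝ} (hp : 0 < p) (c : ℂ) (f : ℂ → ℂ) :
    bergmanNorm p (fun z => c * f z) = ‖c‖ * bergmanNorm p f := by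
  simp only [bergmanNorm, norm_mul, Real.mul_rpow (norm_nonneg _) (norm_nonneg _)]
  rw [integral_const_mul, Real.mul_rpow (by positivity)
    (integral_nonneg fun _ => Real.rpow_nonneg (norm_nonneg _) _), ← Real.rpow_mul (norm_nonneg _),
    mul_one_div_cancel hp.ne', Real.rpow_one]

lemma MemBergman.const_mul {p : ℝ} {f : ℂ → ℂ} (hf : MemBergman p f) (c : ℂ) :
    MemBergman p (fun z => c * f z) := by
  refine ⟨analyticOnNhd_const.mul hf.1, ?_⟩
  simp only [norm_mul, Real.mul_rpow (norm_nonneg _) (norm_nonneg _)]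
  exact hf.2.const_mul _

section HilbertOperator

variable {m : ℕ} {p : ℝ} {f : ℂ → ℂ}

lemma MemBergman.hilbertOp_const_mul (hm : 2 ≤ m) (hp : 2 < p)
    (hf : MemBergman (p * ((m : ℝ) - 1)) f) (c z : ℂ) :
    hilbertOp m (fun w => c * f w) z = c ^ (m - 1) * hilbertOp m f z := by
  have h (k : ℕ) : hilbertCoeff m (taylorCoeff fun w => c * f w) k =
      c ^ (m - 1) * hilbertCoeff m (taylorCoeff f) k := by
    rw [show taylorCoeff (fun w => c * f w) = fun n => c * taylorCoeff f n from
      funext (taylorCoeff_const_mul c f)]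
    -- `limUnder` commutes with scaling here because the limit is known to exist.
    apply Tendsto.limUnder_eq
    simp only [hilbertPartialSum_const_mul]
    exact (hf.tendsto_hilbertPartialSum hm hp k).const_mul _
  simp only [hilbertOp, h, mul_assoc, tsum_mul_left]

lemma hilbertT_of_eq_zero (h : ∀ w ∈ disc, f w = 0) : hilbertT m p f = fun _ => 0 := by
  ext z; rw [hilbertT, if_pos h]

lemma hilbertT_of_ne_zero (h : ¬ ∀ w ∈ disc, f w = 0) : hilbertT m p f = fun z =>
    ((bergmanNorm (p * ((m : ℝ) - 1)) f ^ (2 - (m : ℤ)) : ℝ) : ℂ) * hilbertOp m f z := by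
  ext z; rw [hilbertT, if_neg h]

lemma bergmanNorm_zero (hp : 0 < p) : bergmanNorm p (fun _ => 0) = 0 := by
  simpa using bergmanNorm_const_mul hp 0 (fun _ => 0)

lemma memBergman_zero (hp : p ≠ 0) : MemBergman p (fun _ => 0) :=
  ⟨analyticOnNhd_const, by simp [Real.zero_rpow hp]⟩

lemma memBergman_hilbertT (hm : 2 ≤ m) (hp : 2 < p)
    (hf : MemBergman (p * ((m : ℝ) - 1)) f) {C : ℝ → ℝ} {K : ℝ} (hC : IsPathMajorant p C K) :
    MemBergman p (hilbertT m p f) := by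
  by_cases h : ∀ w ∈ disc, f w = 0
  · rw [hilbertT_of_eq_zero h]
    exact memBergman_zero (by linarith)
  · rw [hilbertT_of_ne_zero h]
    exact (hf.memBergman_hilbertOp hm hp hC).const_mul _

/-- At `a = 0` the second factor vanishes whatever default value `0 ^ (2 - m)` has, so the norm of a
nonzero `f` need not be shown positive. -/
lemma zpow_two_sub_mul_pow_le {a : ℝ} (ha : 0 ≤ a) (hm : 2 ≤ m) :
    a ^ (2 - (m : ℤ)) * a ^ (m - 1) ≤ a := by
  rcases ha.eq_or_lt with rfl | ha
  · rw [zero_pow (by omega), mul_zero]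
  · rw [← zpow_natCast, ← zpow_add₀ ha.ne', show 2 - (m : ℤ) + ((m - 1 : ℕ) : ℤ) = 1 by omega,
      zpow_one]

lemma bergmanNorm_hilbertT_le (hm : 2 ≤ m) (hp : 2 < p)
    (hf : MemBergman (p * ((m : ℝ) - 1)) f) {C : ℝ → ℝ} {K : ℝ} (hC : IsPathMajorant p C K) :
    bergmanNorm p (hilbertT m p f) ≤ K * bergmanNorm (p * ((m : ℝ) - 1)) f := by
  have hK := hC.const_pos
  have ha := bergmanNorm_nonneg (p * ((m : ℝ) - 1)) f
  by_cases h : ∀ w ∈ disc, f w = 0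
  · rw [hilbertT_of_eq_zero h, bergmanNorm_zero (by linarith)]
    positivity
  · rw [hilbertT_of_ne_zero h, bergmanNorm_const_mul (by linarith), Complex.norm_real,
      Real.norm_of_nonneg (zpow_nonneg ha _)]
    calc _ ≤ bergmanNorm (p * ((m : ℝ) - 1)) f ^ (2 - (m : ℤ)) *
          (K * bergmanNorm (p * ((m : ℝ) - 1)) f ^ (m - 1)) :=
          mul_le_mul_of_nonneg_left (hf.bergmanNorm_hilbertOp_le hm hp hC) (zpow_nonneg ha _)
      _ = K * (bergmanNorm (p * ((m : ℝ) - 1)) f ^ (2 - (m : ℤ)) *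
          bergmanNorm (p * ((m : ℝ) - 1)) f ^ (m - 1)) := by ring
      _ ≤ _ := mul_le_mul_of_nonneg_left (zpow_two_sub_mul_pow_le ha hm) hK.le

lemma bergmanOpNorm_hilbertT_le (hm : 2 ≤ m) (hp : 2 < p) {C : ℝ → ℝ} {K : ℝ}
    (hC : IsPathMajorant p C K) :
    bergmanOpNorm (p * ((m : ℝ) - 1)) p (hilbertT m p) ≤ K := by
  -- `0 ≤ K` covers the default `sSup ∅ = 0`.
  refine Real.sSup_le ?_ hC.const_pos.le
  rintro _ ⟨f, hf, hf1, rfl⟩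
  simpa [hf1] using bergmanNorm_hilbertT_le hm hp hf hC

lemma isPosHomogeneous_hilbertT (hm : 2 ≤ m) (hp : 2 < p) :
    IsPosHomogeneous (p * ((m : ℝ) - 1)) (hilbertT m p) := by
  intro t ht f hf z _
  have htc : (t : ℂ) ≠ 0 := by exact_mod_cast ht.ne'
  have hq : 0 < p * ((m : ℝ) - 1) := by
    have : (2 : ℝ) ≤ m := by exact_mod_cast hm
    exact mul_pos (by linarith) (by linarith)
  by_cases h : ∀ w ∈ disc, f w = 0
  · have h' : ∀ w ∈ disc, (t : ℂ) * f w = 0 := fun w hw => by rw [h w hw, mul_zero]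
    rw [hilbertT_of_eq_zero h, hilbertT_of_eq_zero h', mul_zero]
  · have h' : ¬ ∀ w ∈ disc, (t : ℂ) * f w = 0 := fun h2 => h fun w hw =>
      (mul_eq_zero.1 (h2 w hw)).resolve_left htc
    rw [hilbertT_of_ne_zero h, hilbertT_of_ne_zero h']
    simp only
    rw [hf.hilbertOp_const_mul hm hp, bergmanNorm_const_mul hq, Complex.norm_real,
      Real.norm_of_nonneg ht.le, mul_zpow]
    have h3 : (t : ℂ) ^ (2 - (m : ℤ)) * (t : ℂ) ^ (m - 1) = t := by
      rw [← zpow_natCast, ← zpow_add₀ htc, show 2 - (m : ℤ) + ((m - 1 : ℕ) : ℤ) = 1 by omega,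
        zpow_one]
    push_cast
    calc _ = ((t : ℂ) ^ (2 - (m : ℤ)) * (t : ℂ) ^ (m - 1)) *
          ((bergmanNorm (p * ((m : ℝ) - 1)) f : ℂ) ^ (2 - (m : ℤ)) * hilbertOp m f z) := by ring
      _ = _ := by rw [h3]

end HilbertOperator

end

theorem theorem3p5 (m : ℕ) (hm : 2 ≤ m) (p : ℝ) (hp : 2 < p) :
    (∀ f : ℂ → ℂ, MemBergman (p * ((m : ℝ) - 1)) f → HilbertOpConverges m f) ∧
    MapsBergman (p * ((m : ℝ) - 1)) p (hilbertT m p) ∧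
    IsPosHomogeneous (p * ((m : ℝ) - 1)) (hilbertT m p) ∧
    IsBoundedOperator (p * ((m : ℝ) - 1)) p (hilbertT m p) ∧
    (4 ≤ p →
      bergmanOpNorm (p * ((m : ℝ) - 1)) p (hilbertT m p) ≤
        Real.pi / Real.sin (2 * Real.pi / p)) ∧
    (p ≤ 4 →
      bergmanOpNorm (p * ((m : ℝ) - 1)) p (hilbertT m p) ≤
        (4 : ℝ) ^ (4 / p - 1) * Real.sqrt Real.pi *
          (Real.Gamma (1 - 2 / p) / Real.Gamma (3 / 2 - 2 / p))) := by
  -- The qualitative claims need only some majorant; the two norm bounds use their own, so both hold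
  -- at `p = 4`.
  obtain ⟨C, K, hC⟩ : ∃ C K, IsPathMajorant p C K := by
    rcases le_total 4 p with h | h
    · exact ⟨_, _, isPathMajorant_of_four_le h⟩
    · exact ⟨_, _, isPathMajorant_of_le_four hp h⟩
  exact ⟨fun f hf => ⟨fun k => ⟨_, hf.tendsto_hilbertPartialSum hm hp k⟩,
      fun z hz => (hf.hasSum_hilbertCoeff hm hp hz).summable⟩,
    fun f hf => memBergman_hilbertT hm hp hf hC,
    isPosHomogeneous_hilbertT hm hp,
    ⟨K, hC.const_pos, fun f hf => bergmanNorm_hilbertT_le hm hp hf hC⟩,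
    fun h => bergmanOpNorm_hilbertT_le hm hp (isPathMajorant_of_four_le h),
    fun h => bergmanOpNorm_hilbertT_le hm hp (isPathMajorant_of_le_four hp h)⟩
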